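/- **Tracts.** A tract $F=(G,N_G)$ is an abelian group $G$ (written multiplicatively) with a subset $N_G$ of the group semiring $\mathbb N[G]$ such that $0\in N_G$; $1\notin N_G$; there is a unique $\epsilon\in G$ with $1+\epsilon\in N_G$; and $N_G$ is stable under multiplication by elements of $G$. We identify $F$ with $G\cup\{0\}\subset\mathbb N[G]$ and write $-x$ for $\epsilon x$. Fix an involution $x\mapsto\overline x$ of $F$, i.e. a group endomorphism of $G$ with square the identity, mapping $0$ to $0$, whose linear extension to $\mathbb N[G]$ maps $N_G$ into $N_G$ (for example the identity). Let $E$ be a finite set. The support of $X\in F^E$ is $\underline X=\{e: X(e)\ne 0\}$, and $X\perp Y$ means $\sum_{e\in E}X(e)\overline{Y(e)}\in N_G$. For $S\subseteq F^E$, $S^\perp$ is the set of all $X$ with $X\perp Y$ for all $Y\in S$, and $\mathrm{SuppMin}(S)$ is the set of elements of $S$ of inclusion-minimal support. **Matroids over $F$.** A set $\mathcal C\subseteq F^E$ is the $F$-circuit set of a *weak $F$-matroid* on $E$ if * (C0) $0\notin\mathcal C$; * (C1) if $X\in\mathcal C$ and $\alpha\in G$, then $\alpha X\in\mathcal C$;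 * (C2) if $X,Y\in\mathcal C$ and $\underline X\subseteq\underline Y$, then $X=\alpha Y$ for some $\alpha\in G$; * (C3)$'$ if $X,Y\in\mathcal C$, the supports $\underline X\neq\underline Y$ form a modular pair (i.e. $\underline X\cup\underline Y$ does not properly contain a union of two distinct supports of elements of $\mathcal C$), and $X(e)=-Y(e)\ne0$, then there is $Z\in\mathcal C$ with $Z(e)=0$ and $X(f)+Y(f)-Z(f)\in N_G$ for all $f\in E$. It is the $F$-circuit set of a *strong $F$-matroid* if (C0)–(C2) hold together with * (C3) if $X,X_1,\dots,X_k\in\mathcal C$ ($k \geq 0$) are such that $\underline X\cup\underline X_1\cup\dots\cup\underline X_k$ has height $k+1$ in the lattice of all unions of supports of elements of $\mathcal C$, if $\underline X\not\subseteq\bigcup_i\underline X_i$, and if $e_i\in(\underline X\cap\underline X_i)\setminus\bigcup_{j\ne i}\underline X_j$ satisfies $X(e_i)=-X_i(e_i)$ for $1\le i\le k$, then there is $Z\in\mathcal C$ with $Z(e_i)=0$ for all $i$ and $X_1(f)+\dots+X_k(f)+X(f)-Z(f)\in N_G$ for all $f\in E$. The *underlying matroid* $\underline M$ of such an $F$-matroid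 $M$ is the matroid on $E$ whose circuits are the supports of the elements of $\mathcal C$. **Duals.** The dual $M^*$ of a strong $F$-matroid $M$ is the strong $F$-matroid with $F$-circuit set $\mathcal C^*=\mathrm{SuppMin}(\mathcal C^\perp\setminus\{0\})$. The dual $M^*$ of a weak $F$-matroid $M$ is the weak $F$-matroid whose $F$-circuit set is the unique $\mathcal D\subseteq F^E$ such that $(\mathcal C,\mathcal D)$ is a weak dual pair of $F$-signatures of $\underline M$. This means: $\mathcal C$ and $\mathcal D$ satisfy (C0) and (C1); taking supports gives a bijection from $\mathcal C$ modulo $G$ to the circuits of $\underline M$, and from $\mathcal D$ modulo $G$ to the circuits of the dual matroid $\underline M^*$; and $X\perp Y$ for all $X\in\mathcal C$, $Y\in\mathcal D$ with $|\underline X\cap\underline Y|\le3$. **Minors.** For $A\subseteq E$ let $$\mathcal C\setminus A=\{X|_{E\setminus A}: X\in\mathcal C,\ \underline X\cap A=\emptyset\},\qquad \mathcal C/A=\mathrm{SuppMin}\bigl(\{X|_{E\setminus A}: X\in\mathcal C\}\setminus\{0\}\bigr).$$ **Theorem.** Let $\mathcal C$ be the $F$-circuit set of a strong (resp. weak) $F$-matroid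 $M$ on $E$, and let $A\subseteq E$. Then $\mathcal C\setminus A$ is the $F$-circuit set of a strong (resp. weak) $F$-matroid $M\setminus A$ on $E\setminus A$ with underlying matroid $\underline M\setminus A$, and $\mathcal C/A$ is the $F$-circuit set of a strong (resp. weak) $F$-matroid $M/A$ on $E\setminus A$ with underlying matroid $\underline M/A$. Moreover $M^*$ is well defined, and $(M\setminus A)^*=M^*/A$ and $(M/A)^*=M^*\setminus A$. -/

import Mathlib

/-- A tract with multiplicative group `G`: an additive relation structure on `G`, that is, a set
`null` of formal sums in the group semiring `ℕ[G]`, subject to the four tract axioms. -/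
structure Tract (G : Type*) [CommGroup G] where
  /-- the formal sums that "sum to zero" -/
  null : Set (MonoidAlgebra ℕ G)
  zero_mem : 0 ∈ null
  one_notMem : 1 ∉ null
  existsUnique_neg_one : ∃! ε : G, 1 + MonoidAlgebra.of ℕ G ε ∈ null
  smul_mem : ∀ (g : G), ∀ x ∈ null, MonoidAlgebra.of ℕ G g * x ∈ null

namespace Tract

/-- The elements of the tract, `G ∪ {0}`, are represented by `WithZero G`; this is the inclusion of
`G ∪ {0}` into the group semiring `ℕ[G]`. -/
noncomputable def toSum {G : Type*} [CommGroup G] : WithZero G →*₀ MonoidAlgebra ℕ G :=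
  WithZero.lift' (MonoidAlgebra.of ℕ G)

/-- The element `-1` of a tract: the unique `ε` in `G` for which `1 + ε` is null. -/
noncomputable def negOne {G : Type*} [CommGroup G] (F : Tract G) : G :=
  F.existsUnique_neg_one.choose

/-- Negation in a tract: multiplication by `-1`. -/
noncomputable def neg {G : Type*} [CommGroup G] (F : Tract G) (x : WithZero G) : WithZero G :=
  (F.negOne : WithZero G) * x

/-- An involution of a tract: a tract endomorphism whose square is the identity. -/
structure Involution {G : Type*} [CommGroup G] (F : Tract G) where
  hom : G →* G
  map_null : ∀ x ∈ F.null, MonoidAlgebra.mapDomain hom x ∈ F.null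
  hom_hom : ∀ g, hom (hom g) = g

/-- The action of an involution on `G ∪ {0}`. -/
noncomputable def Involution.conj {G : Type*} [CommGroup G] {F : Tract G} (τ : F.Involution) :
    WithZero G →*₀ WithZero G :=
  WithZero.map' τ.hom

/-! ### Vectors, supports and orthogonality -/

/-- The set of supports of the members of a set of vectors. -/
def supports {G E : Type*} (C : Set (E → WithZero G)) : Set (Set E) :=
  Function.support '' C

/-- The members of `S` of (inclusion-)minimal support. -/
def suppMin {G E : Type*} (S : Set (E → WithZero G)) : Set (E → WithZero G) :=
  {X | X ∈ S ∧ ∀ Y ∈ S, Function.support Y ⊆ Function.support X →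
    Function.support Y = Function.support X}

/-- `X ⊥ Y`: the inner product `∑ X(e) * conj (Y(e))` (a finite sum whenever `E` is finite) is
null. -/
def Orthogonal {G E : Type*} [CommGroup G] (F : Tract G) (τ : F.Involution)
    (X Y : E → WithZero G) : Prop :=
  ∑ᶠ e, toSum (X e * τ.conj (Y e)) ∈ F.null

/-- The orthogonal complement of a set of vectors. -/
def orthogonalComplement {G E : Type*} [CommGroup G] (F : Tract G) (τ : F.Involution)
    (S : Set (E → WithZero G)) : Set (E → WithZero G) :=
  {X | ∀ Y ∈ S, F.Orthogonal τ X Y}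

/-! ### Modular pairs and modular families -/

/-- `C₁, C₂` form a modular pair in the collection `S` of subsets of `E`. -/
def IsModularPair {E : Type*} (S : Set (Set E)) (C₁ C₂ : Set E) : Prop :=
  C₁ ∈ S ∧ C₂ ∈ S ∧ C₁ ≠ C₂ ∧
    ¬ ∃ C₃ ∈ S, ∃ C₄ ∈ S, C₃ ≠ C₄ ∧ C₃ ∪ C₄ ⊂ C₁ ∪ C₂

/-- The lattice (ordered by inclusion) of all unions of members of `S`. -/
def unionLattice {E : Type*} (S : Set (Set E)) : Set (Set E) :=
  {U | ∃ T ⊆ S, U = ⋃₀ T}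

/-- A family `C₁, …, Cₙ` of members of `S` is modular if the height of its join in the lattice of
unions of members of `S` is equal to its size `n`. -/
def IsModularFamily {E : Type*} (S : Set (Set E)) {n : ℕ} (C : Fin n → Set E) : Prop :=
  (∀ i, C i ∈ S) ∧
    ∃ h : (⋃ i, C i) ∈ unionLattice S,
      Order.height (⟨⋃ i, C i, h⟩ : unionLattice S) = (n : ℕ∞)

/-! ### Circuit sets of weak and strong matroids over a tract -/

/-- The axioms common to weak and strong matroids: (C0), (C1) and (C2). -/
structure IsPreCircuitSet {G E : Type*} [CommGroup G] (C : Set (E → WithZero G)) : Prop where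
  zero_notMem : (0 : E → WithZero G) ∉ C
  smul_mem : ∀ X ∈ C, ∀ α : G, (α : WithZero G) • X ∈ C
  incomparable : ∀ X ∈ C, ∀ Y ∈ C, Function.support X ⊆ Function.support Y →
    ∃ α : G, X = (α : WithZero G) • Y

/-- `C` is the `F`-circuit set of a weak `F`-matroid on `E`: (C0), (C1), (C2) and modular
elimination. -/
structure IsWeakCircuitSet {G E : Type*} [CommGroup G] (F : Tract G)
    (C : Set (E → WithZero G)) : Prop extends IsPreCircuitSet C where
  modular_elimination : ∀ X ∈ C, ∀ Y ∈ C,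
    IsModularPair (supports C) (Function.support X) (Function.support Y) →
    ∀ e : E, X e = F.neg (Y e) → X e ≠ 0 →
      ∃ Z ∈ C, Z e = 0 ∧
        ∀ f, toSum (X f) + toSum (Y f) + toSum (F.neg (Z f)) ∈ F.null

/-- `C` is the `F`-circuit set of a strong `F`-matroid on `E`: (C0), (C1), (C2) and strong modular
elimination. -/
structure IsStrongCircuitSet {G E : Type*} [CommGroup G] (F : Tract G)
    (C : Set (E → WithZero G)) : Prop extends IsPreCircuitSet C where
  strong_modular_elimination : ∀ (k : ℕ) (X : E → WithZero G) (Y : Fin k → E → WithZero G),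
    X ∈ C → (∀ i, Y i ∈ C) →
    IsModularFamily (supports C)
      (Fin.cons (Function.support X) (fun i => Function.support (Y i)) : Fin (k + 1) → Set E) →
    ¬ Function.support X ⊆ ⋃ i, Function.support (Y i) →
    ∀ e : Fin k → E,
      (∀ i, e i ∈ Function.support X ∩ Function.support (Y i) ∧
        ∀ j, j ≠ i → e i ∉ Function.support (Y j)) →
      (∀ i, X (e i) = F.neg (Y i (e i))) →
      ∃ Z ∈ C, (∀ i, Z (e i) = 0) ∧
        ∀ f, ∑ i, toSum (Y i f) + toSum (X f) + toSum (F.neg (Z f)) ∈ F.null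

/-- `M` is the underlying matroid of `C`: the matroid on `E` whose circuits are the supports of the
members of `C`. -/
def IsUnderlyingMatroid {G E : Type*} (C : Set (E → WithZero G)) (M : Matroid E) : Prop :=
  M.E = Set.univ ∧ ∀ K : Set E, M.IsCircuit K ↔ K ∈ supports C

/-! ### Deletion and contraction -/

/-- `C ∖ A`: the restrictions to `E ∖ A` of the members of `C` whose support is disjoint
from `A`. -/
def deletion {G E : Type*} (C : Set (E → WithZero G)) (A : Set E) :
    Set (↥(Aᶜ) → WithZero G) :=
  {W | ∃ X ∈ C, Function.support X ∩ A = ∅ ∧ W = fun e : ↥(Aᶜ) => X e}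

/-- `C / A`: the restrictions to `E ∖ A` of members of `C` that have minimal support among the
nonzero ones. -/
def contraction {G E : Type*} (C : Set (E → WithZero G)) (A : Set E) :
    Set (↥(Aᶜ) → WithZero G) :=
  suppMin ({W | ∃ X ∈ C, W = fun e : ↥(Aᶜ) => X e} \ {0})

/-! ### Duals -/

/-- The circuit set `C*` of the dual of a strong `F`-matroid with circuit set `C`: the elements of
minimal support among the nonzero vectors orthogonal to `C`. -/
def dual {G E : Type*} [CommGroup G] (F : Tract G) (τ : F.Involution)
    (C : Set (E → WithZero G)) : Set (E → WithZero G) :=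
  suppMin (F.orthogonalComplement τ C \ {0})

/-- `C` is an `F`-signature of the matroid `M`: `0 ∉ C`, `C` is closed under nonzero scalars, and
taking supports is a bijection from the classes of `C` modulo scalars to the circuits of `M`. -/
structure IsSignature {G E : Type*} [CommGroup G] (M : Matroid E)
    (C : Set (E → WithZero G)) : Prop where
  zero_notMem : (0 : E → WithZero G) ∉ C
  smul_mem : ∀ X ∈ C, ∀ α : G, (α : WithZero G) • X ∈ C
  isCircuit : ∀ X ∈ C, M.IsCircuit (Function.support X)
  surjective : ∀ K, M.IsCircuit K → ∃ X ∈ C, Function.support X = K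
  injective : ∀ X ∈ C, ∀ Y ∈ C, Function.support X = Function.support Y →
    ∃ α : G, X = (α : WithZero G) • Y

/-- `(C, D)` is a weak dual pair of `F`-signatures of the matroid `M` on `E`. -/
structure IsWeakDualPair {G E : Type*} [CommGroup G] (F : Tract G) (τ : F.Involution)
    (M : Matroid E) (C D : Set (E → WithZero G)) : Prop where
  ground : M.E = Set.univ
  left : IsSignature M C
  right : IsSignature M✶ D
  orthogonal : ∀ X ∈ C, ∀ Y ∈ D,
    (Function.support X ∩ Function.support Y).ncard ≤ 3 → F.Orthogonal τ X Y

/-- `D` is the set of `F`-cocircuits of the weak `F`-matroid with `F`-circuit set `C`, i.e. the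
`F`-circuit set of its dual: `(C, D)` is a weak dual pair for a matroid, necessarily the underlying
matroid of `C`. -/
def IsWeakDual {G E : Type*} [CommGroup G] (F : Tract G) (τ : F.Involution)
    (C D : Set (E → WithZero G)) : Prop :=
  ∃ M : Matroid E, F.IsWeakDualPair τ M C D

end Tract

/-! Elimination axioms are awkward under contraction and say little about duals, while orthogonality
behaves well under both. So a weak (strong) circuit set `C` is recognised as one half of a dual pair
`(C, D)`: signatures of `M` and of its dual such that `X ⊥ Y` whenever the supports share at most
`m` elements, with `m = 3` for weak and `m = ⊤` for strong (`IsDualPair`). This notion is symmetric,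
because the involution turns `X ⊥ Y` into `Y ⊥ X`. It also passes to minors when `C` is contracted
and `D` deleted: the surviving vectors of `D` vanish on `A`, so inner products and common supports
do not change.

The bridge matches elimination of `k` elements with orthogonality at `k + 2` common elements. Given
orthogonality, each coordinate of the elimination relation is read off from a cocircuit isolating
that coordinate (`elimAt_of_orthogonal`). Conversely, eliminating all but two of the elements that
`X` shares with a cocircuit reduces orthogonality to the case of two common elements
(`orthogonal_of_elimAt`). That case defines `D`: circuits meeting a cocircuit in two elements
prescribe ratios of values on it, and modular elimination along basis exchanges makes these ratios
consistent (`cross_eq`, `exists_orthogonal_of_isCocircuit`). The same ratios make `D` unique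
(`IsDualPair.eq_cosignature`); in the strong case `D` is the set of minimal-support vectors of the
orthogonal complement (`IsDualPair.dual_eq`).

Two translations support this. Height in the lattice of unions of circuits is nullity
(`height_unionLattice`), so modularity becomes counting. Modular elimination implies ordinary
circuit elimination, so an underlying matroid exists
(`IsWeakCircuitSet.exists_isUnderlyingMatroid`). -/

namespace Tract

/-! ### Arithmetic in a tract with involution -/

section Algebra

variable {G : Type*} [CommGroup G] (F : Tract G)

theorem toSum_coe (g : G) : toSum (g : WithZero G) = MonoidAlgebra.of ℕ G g :=
  WithZero.lift'_coe _ _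

theorem toSum_mul_mem (a : WithZero G) {x : MonoidAlgebra ℕ G} (hx : x ∈ F.null) :
    toSum a * x ∈ F.null := by
  induction a using WithZero.recZeroCoe with
  | zero => simpa using F.zero_mem
  | coe g => rw [toSum_coe]; exact F.smul_mem g x hx

theorem toSum_mul_mem_iff {a : WithZero G} (ha : a ≠ 0) {x : MonoidAlgebra ℕ G} :
    toSum a * x ∈ F.null ↔ x ∈ F.null := by
  refine ⟨fun h => ?_, F.toSum_mul_mem a⟩
  have := F.toSum_mul_mem a⁻¹ h
  rwa [← mul_assoc, ← map_mul, inv_mul_cancel₀ ha, map_one, one_mul] at this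

theorem toSum_mem_iff {a : WithZero G} : toSum a ∈ F.null ↔ a = 0 := by
  refine ⟨fun h => ?_, fun h => by simpa [h] using F.zero_mem⟩
  by_contra ha
  rw [← mul_one (toSum a), F.toSum_mul_mem_iff ha] at h
  exact F.one_notMem h

theorem one_add_negOne : 1 + toSum (F.negOne : WithZero G) ∈ F.null := by
  rw [toSum_coe]
  exact F.existsUnique_neg_one.choose_spec.1

theorem eq_negOne {a : WithZero G} (h : 1 + toSum a ∈ F.null) : a = F.negOne := by
  induction a using WithZero.recZeroCoe with
  | zero => exact absurd (by simpa using h) F.one_notMem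
  | coe g =>
    rw [toSum_coe] at h
    exact congrArg _ (F.existsUnique_neg_one.unique h F.existsUnique_neg_one.choose_spec.1)

theorem add_mem_iff {a b : WithZero G} : toSum a + toSum b ∈ F.null ↔ b = F.neg a := by
  rcases eq_or_ne a 0 with rfl | ha
  · simp [toSum_mem_iff, neg]
  · have h : toSum a + toSum b = toSum a * (1 + toSum (a⁻¹ * b)) := by
      rw [mul_add, mul_one, ← map_mul, mul_inv_cancel_left₀ ha]
    rw [h, F.toSum_mul_mem_iff ha]
    constructor
    · intro h1
      rw [neg, ← F.eq_negOne h1, mul_comm, mul_inv_cancel_left₀ ha]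
    · rintro rfl
      rw [neg, mul_comm _ a, inv_mul_cancel_left₀ ha]
      exact F.one_add_negOne

theorem neg_neg (a : WithZero G) : F.neg (F.neg a) = a :=
  (F.add_mem_iff.1 (by rw [add_comm]; exact F.add_mem_iff.2 rfl)).symm

theorem neg_mul (a b : WithZero G) : F.neg a * b = F.neg (a * b) := mul_assoc _ _ _

theorem mul_neg (a b : WithZero G) : a * F.neg b = F.neg (a * b) := mul_left_comm _ _ _

theorem neg_zero : F.neg 0 = 0 := mul_zero _

theorem neg_eq_zero {a : WithZero G} : F.neg a = 0 ↔ a = 0 := by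
  simp [neg]

theorem eq_neg_comm {a b : WithZero G} : a = F.neg b ↔ b = F.neg a :=
  ⟨fun h => by rw [h, neg_neg], fun h => by rw [h, neg_neg]⟩

variable {F} (τ : F.Involution)

theorem Involution.conj_coe (g : G) : τ.conj (g : WithZero G) = (τ.hom g : WithZero G) :=
  WithZero.map'_coe _ _

theorem Involution.conj_conj (a : WithZero G) : τ.conj (τ.conj a) = a := by
  induction a using WithZero.recZeroCoe with
  | zero => simp
  | coe g => rw [conj_coe, conj_coe, τ.hom_hom]

theorem Involution.mapDomain_toSum (a : WithZero G) :
    MonoidAlgebra.mapDomain τ.hom (toSum a) = toSum (τ.conj a) := by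
  induction a using WithZero.recZeroCoe with
  | zero => simp
  | coe g => rw [conj_coe, toSum_coe, toSum_coe]; simp

theorem Involution.mapDomain_sum {ι : Type*} (s : Finset ι) (f : ι → WithZero G) :
    MonoidAlgebra.mapDomain τ.hom (∑ i ∈ s, toSum (f i)) = ∑ i ∈ s, toSum (τ.conj (f i)) := by
  simp_rw [← τ.mapDomain_toSum]
  exact map_sum (MonoidAlgebra.mapDomainNonUnitalRingHom ℕ τ.hom.toMulHom) _ _

theorem Involution.sum_conj_mem {ι : Type*} {s : Finset ι} {f : ι → WithZero G}
    (h : ∑ i ∈ s, toSum (f i) ∈ F.null) : ∑ i ∈ s, toSum (τ.conj (f i)) ∈ F.null := by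
  rw [← τ.mapDomain_sum]
  exact τ.map_null _ h

theorem Involution.conj_eq_zero {a : WithZero G} : τ.conj a = 0 ↔ a = 0 := map_eq_zero _

end Algebra

/-! ### Orthogonality of vectors -/

section Orthogonality

variable {G E : Type*} [CommGroup G] {F : Tract G} {τ : F.Involution}
variable {X Y : E → WithZero G}

open Function

theorem orthogonal_iff_sum (s : Finset E) (hs : support X ∩ support Y ⊆ s) :
    F.Orthogonal τ X Y ↔ ∑ e ∈ s, toSum (X e * τ.conj (Y e)) ∈ F.null := by
  rw [Orthogonal, finsum_eq_sum_of_support_subset]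
  refine subset_trans (fun e he => ?_) hs
  refine ⟨fun h => he (by simp [h]), fun h => he (by simp [h])⟩

theorem Orthogonal.symm [Finite E] (h : F.Orthogonal τ X Y) : F.Orthogonal τ Y X := by
  have := Fintype.ofFinite E
  rw [orthogonal_iff_sum Finset.univ (by simp)] at h ⊢
  convert τ.sum_conj_mem h using 3
  rw [map_mul, τ.conj_conj, mul_comm]

theorem orthogonal_of_disjoint (h : support X ∩ support Y = ∅) : F.Orthogonal τ X Y := by
  rw [orthogonal_iff_sum ∅ (by simp [h])]
  simpa using F.zero_mem

theorem orthogonal_iff_pair {a b : E} (hab : a ≠ b) (h : support X ∩ support Y ⊆ {a, b}) :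
    F.Orthogonal τ X Y ↔ X b * τ.conj (Y b) = F.neg (X a * τ.conj (Y a)) := by
  classical
  rw [orthogonal_iff_sum {a, b} (by simpa using h), Finset.sum_pair hab, F.add_mem_iff]

theorem not_orthogonal_of_singleton {a : E} (h : support X ∩ support Y = {a}) :
    ¬ F.Orthogonal τ X Y := by
  rw [orthogonal_iff_sum {a} (by simp [h]), Finset.sum_singleton, F.toSum_mem_iff]
  have ha : a ∈ support X ∩ support Y := by simp [h]
  simpa [τ.conj_eq_zero] using ha

theorem support_smul_coe (α : G) : support ((α : WithZero G) • X) = support X := by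
  ext e; simp

theorem Orthogonal.smul_left (h : F.Orthogonal τ X Y) [Finite E] (α : WithZero G) :
    F.Orthogonal τ (α • X) Y := by
  have := Fintype.ofFinite E
  rw [orthogonal_iff_sum Finset.univ (by simp)] at h ⊢
  convert F.toSum_mul_mem α h using 1
  simp [Finset.mul_sum, mul_assoc]

theorem Orthogonal.smul_right (h : F.Orthogonal τ X Y) [Finite E] (α : WithZero G) :
    F.Orthogonal τ X (α • Y) :=
  (h.symm.smul_left α).symm

end Orthogonality
end Tract

namespace Matroid

open Set

variable {α : Type*} {M : Matroid α}

/-! ### Nullity and circuits -/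

section Nullity

/-- The nullity of a set in a matroid: the difference of its size and its rank. -/
noncomputable def nul (M : Matroid α) (U : Set α) : ℕ := U.ncard - (M.eRk U).toNat

variable [_root_.Finite α] {I U V K : Set α} {e : α}

theorem IsBasis.nul_eq (h : M.IsBasis I U) : M.nul U = (U \ I).ncard := by
  rw [nul, h.eRk_eq_encard, ncard_sdiff h.subset]
  rfl

theorem Indep.nul_le (h : M.Indep I) (hIU : I ⊆ U) (hU : U ⊆ M.E) : M.nul U ≤ (U \ I).ncard := by
  obtain ⟨J, hJ, hIJ⟩ := h.subset_isBasis_of_subset hIU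
  rw [hJ.nul_eq]
  exact ncard_le_ncard (sdiff_subset_sdiff_right hIJ)

theorem nul_mono (h : U ⊆ V) (hV : V ⊆ M.E) : M.nul U ≤ M.nul V := by
  obtain ⟨I, hI⟩ := M.exists_isBasis U (h.trans hV)
  obtain ⟨J, hJ, hIJ⟩ := hI.indep.subset_isBasis_of_subset (hI.subset.trans h)
  rw [hI.nul_eq, hJ.nul_eq]
  refine ncard_le_ncard fun x hx => ⟨h hx.1, fun hxJ => hx.2 ?_⟩
  exact hI.mem_of_insert_indep hx.1 (hJ.indep.subset (insert_subset hxJ hIJ))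

theorem nul_eq_zero (hU : U ⊆ M.E) : M.nul U = 0 ↔ M.Indep U := by
  obtain ⟨I, hI⟩ := M.exists_isBasis U
  rw [hI.nul_eq, ncard_eq_zero, sdiff_eq_empty]
  exact ⟨fun h => hI.indep.subset h, fun h => (hI.eq_of_subset_indep h hI.subset subset_rfl).ge⟩

/-- A basis of `U \ {e}` containing `K \ {e}` already spans `e`, so it is also a basis of `U`. -/
theorem IsCircuit.nul_sdiff_singleton (hK : M.IsCircuit K) (hKU : K ⊆ U) (he : e ∈ K)
    (hU : U ⊆ M.E) : M.nul (U \ {e}) + 1 = M.nul U := by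
  obtain ⟨I, hI, hKI⟩ := (hK.sdiff_singleton_indep he).subset_isBasis_of_subset
    (sdiff_subset_sdiff_left (t := {e}) hKU) (sdiff_subset.trans hU)
  have hIU : M.IsBasis I U := by
    refine hI.indep.isBasis_of_subset_of_subset_closure (hI.subset.trans sdiff_subset) fun x hx => ?_
    by_cases hxe : x = e
    · subst hxe
      exact M.closure_subset_closure hKI (hK.mem_closure_sdiff_singleton_of_mem he)
    · exact hI.subset_closure ⟨hx, hxe⟩
  rw [hI.nul_eq, hIU.nul_eq]
  have h1 : e ∈ U \ I := ⟨hKU he, fun h => (hI.subset h).2 rfl⟩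
  rw [← ncard_sdiff_singleton_add_one h1, sdiff_sdiff_comm]

theorem nul_union_le (T : Set α) (h : U ∪ T ⊆ M.E) : M.nul (U ∪ T) ≤ M.nul U + T.ncard := by
  obtain ⟨I, hI⟩ := M.exists_isBasis U (subset_union_left.trans h)
  rw [hI.nul_eq]
  refine (hI.indep.nul_le (hI.subset.trans subset_union_left) h).trans ?_
  refine (ncard_le_ncard (t := (U \ I) ∪ T) ?_).trans (ncard_union_le _ _)
  rintro x ⟨hx | hx, hxI⟩
  · exact Or.inl ⟨hx, hxI⟩
  · exact Or.inr hx

theorem Indep.nul_union_le (hI : M.Indep I) (T : Set α) (h : I ∪ T ⊆ M.E) (hU : U ⊆ I ∪ T) :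
    M.nul U ≤ T.ncard := by
  have h1 := Matroid.nul_union_le T h
  rw [(nul_eq_zero hI.subset_ground).2 hI, zero_add] at h1
  exact (nul_mono hU h).trans h1

/-- Elements of `U` on no circuit inside `U` can be added to any basis of the union, so discarding
them lowers size and rank equally. -/
theorem nul_sUnion_isCircuit (hU : U ⊆ M.E) : M.nul (⋃₀ {K | M.IsCircuit K ∧ K ⊆ U}) = M.nul U := by
  have hV : ⋃₀ {K | M.IsCircuit K ∧ K ⊆ U} ⊆ U := sUnion_subset fun K hK => hK.2
  generalize hVd : ⋃₀ {K | M.IsCircuit K ∧ K ⊆ U} = V at hV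
  refine (nul_mono hV hU).antisymm ?_
  obtain ⟨I, hI⟩ := M.exists_isBasis V (hV.trans hU)
  have hJ : M.Indep (I ∪ (U \ V)) := by
    rw [indep_iff_forall_subset_not_isCircuit
      (union_subset hI.indep.subset_ground (sdiff_subset.trans hU))]
    intro K hKJ hK
    have hKU : K ⊆ U := hKJ.trans (union_subset (hI.subset.trans hV) sdiff_subset)
    have hKV : K ⊆ V := hVd ▸ subset_sUnion_of_mem ⟨hK, hKU⟩
    refine hK.not_indep (hI.indep.subset fun x hx => ?_)
    exact (hKJ hx).resolve_right fun h => h.2 (hKV hx)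
  rw [hI.nul_eq]
  refine (hJ.nul_le (union_subset (hI.subset.trans hV) sdiff_subset) hU).trans (ncard_le_ncard ?_)
  rintro x ⟨hx, hx'⟩
  simp only [mem_union, mem_sdiff, not_or, not_and, not_not] at hx'
  exact ⟨hx'.2 hx, hx'.1⟩

/-- The `e i` are removed one at a time: no other `e j` lies on `Y i`, so `Y i` is still intact when
its own element is removed. -/
theorem nul_sdiff_range {k : ℕ} {Y : Fin k → Set α} (hY : ∀ i, M.IsCircuit (Y i))
    (hYU : ∀ i, Y i ⊆ U) (hU : U ⊆ M.E) {e : Fin k → α} (he : ∀ i, e i ∈ Y i)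
    (hne : ∀ i j, j ≠ i → e i ∉ Y j) : M.nul (U \ range e) + k = M.nul U := by
  have key : ∀ s : Finset (Fin k), M.nul (U \ e '' s) + s.card = M.nul U := by
    intro s
    induction s using Finset.induction_on with
    | empty => simp
    | insert i s hi ih =>
      rw [← ih, Finset.card_insert_of_notMem hi, Finset.coe_insert, image_insert_eq,
        ← (hY i).nul_sdiff_singleton (U := U \ e '' s) _ (he i) (sdiff_subset.trans hU),
        sdiff_sdiff, union_singleton]
      · ring
      · refine subset_sdiff.2 ⟨hYU i, disjoint_left.2 ?_⟩
        rintro _ hx ⟨j, hj, rfl⟩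
        exact hne j i (fun h => hi (h ▸ hj)) hx
  simpa using key Finset.univ

end Nullity

/-! ### Heights in the lattice of unions of circuits -/

section UnionLattice

variable [_root_.Finite α] {S : Set (Set α)}

/-- Nullity is strictly monotone on unions of circuits, since a new point lies on a circuit; this
bounds the height above. Below, removing a point of a circuit and keeping the union of the remaining
circuits lowers the nullity by exactly one, which produces a chain of full length. -/
theorem height_unionLattice (hE : M.E = univ) (hS : ∀ K, M.IsCircuit K ↔ K ∈ S) {U : Set α}
    (hU : U ∈ Tract.unionLattice S) :
    Order.height (⟨U, hU⟩ : Tract.unionLattice S) = M.nul U := by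
  have hsub : ∀ V : Set α, V ⊆ M.E := fun V => by simp [hE]
  refine le_antisymm ?_ ?_
  · have hmono : StrictMono fun V : Tract.unionLattice S => M.nul V.1 := by
      rintro ⟨V, T, hT, rfl⟩ ⟨W, T', hT', rfl⟩ hVW
      obtain ⟨hle, hnot⟩ : ⋃₀ T ⊆ ⋃₀ T' ∧ ¬ ⋃₀ T' ⊆ ⋃₀ T := hVW
      obtain ⟨x, hx, hxV⟩ := not_subset.1 hnot
      obtain ⟨K, hK, hxK⟩ := hx
      have h1 := ((hS K).2 (hT' hK)).nul_sdiff_singleton (subset_sUnion_of_mem hK) hxK (hsub _)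
      have h2 : M.nul (⋃₀ T) ≤ M.nul (⋃₀ T' \ {x}) :=
        nul_mono (subset_sdiff_singleton hle hxV) (hsub _)
      show M.nul (⋃₀ T) < M.nul (⋃₀ T')
      omega
    have := Order.height_le_height_apply_of_strictMono _ hmono ⟨U, hU⟩
    simpa using this
  · induction hn : M.nul U generalizing U with
    | zero => simp
    | succ n ih =>
      obtain ⟨T, hT, rfl⟩ := id hU
      have hne : ∃ K ∈ T, K.Nonempty := by
        by_contra! h
        have : ⋃₀ T = ∅ := sUnion_eq_empty.2 h
        rw [this, (nul_eq_zero (empty_subset _)).2 M.empty_indep] at hn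
        omega
      obtain ⟨K, hK, x, hx⟩ := hne
      have h1 := ((hS K).2 (hT hK)).nul_sdiff_singleton (subset_sUnion_of_mem hK) hx (hsub _)
      have h2 := nul_sUnion_isCircuit (M := M) (U := ⋃₀ T \ {x}) (hsub _)
      have hV : ⋃₀ {K | M.IsCircuit K ∧ K ⊆ ⋃₀ T \ {x}} ∈ Tract.unionLattice S :=
        ⟨_, fun K hK => (hS K).1 hK.1, rfl⟩
      have hVU : ⋃₀ {K | M.IsCircuit K ∧ K ⊆ ⋃₀ T \ {x}} ⊆ ⋃₀ T \ {x} := sUnion_subset fun K hK => hK.2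
      have h3 := ih hV (by omega)
      have hlt : (⟨_, hV⟩ : Tract.unionLattice S) < ⟨⋃₀ T, hU⟩ := by
        refine lt_of_le_not_ge (hVU.trans sdiff_subset) fun hge => ?_
        exact (hVU (hge (subset_sUnion_of_mem hK hx))).2 rfl
      have h4 := Order.height_add_one_le hlt
      refine le_trans ?_ h4
      push_cast
      gcongr

end UnionLattice

/-! ### Circuits meeting a cocircuit in two elements -/

section Cocircuit

variable {K B X : Set α} {e f : α}

theorem IsCocircuit.isBase_insert (hK : M.IsCocircuit K) (hB : M.IsBasis B (M.E \ K))
    (he : e ∈ K) : M.IsBase (insert e B) := by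
  have hmin := isCocircuit_iff_minimal_compl_nonspanning.1 hK
  have heE : e ∈ M.E := hK.subset_ground he
  have hsp : M.Spanning (M.E \ (K \ {e})) := by
    by_contra h
    exact (hmin.2 h sdiff_subset he).2 rfl
  have hset : M.E \ (K \ {e}) = insert e (M.E \ K) := by
    ext x; by_cases hx : x = e <;> simp [hx, heE]
  have hcl : M.closure (insert e B) = M.E := by
    rw [← M.closure_insert_closure_eq_closure_insert, hB.closure_eq_closure,
      M.closure_insert_closure_eq_closure_insert, ← hset, hsp.closure_eq]
  have heB : e ∉ M.closure B := by
    intro h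
    refine hmin.1 ((spanning_iff_closure_eq sdiff_subset).2 ?_)
    rw [← hB.closure_eq_closure, ← hcl, closure_insert_eq_of_mem_closure h]
  refine Indep.isBase_of_spanning ?_ ((spanning_iff_closure_eq ?_).2 hcl)
  · exact (hB.indep.insert_indep_iff).2 (Or.inl ⟨heE, heB⟩)
  · exact insert_subset heE hB.indep.subset_ground

/-- The fundamental circuit of `f` over the base `insert e B` can meet `K` only in `e` and `f`; it
must contain `e`, since a circuit and a cocircuit never share exactly one element. -/
theorem IsCocircuit.exists_isCircuit_inter_eq_pair (hK : M.IsCocircuit K)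
    (hB : M.IsBasis B (M.E \ K)) (he : e ∈ K) (hf : f ∈ K) (hef : e ≠ f) :
    ∃ X, M.IsCircuit X ∧ X ⊆ insert f (insert e B) ∧ X ∩ K = {e, f} := by
  have hBK : ∀ x ∈ B, x ∉ K := fun x hx => (hB.subset hx).2
  have hfB : f ∉ insert e B := by
    rintro (h | h)
    · exact hef h.symm
    · exact hBK _ h hf
  have hc := (hK.isBase_insert hB he).fundCircuit_isCircuit (hK.subset_ground hf) hfB
  have hss := M.fundCircuit_subset_insert f (insert e B)
  have hle : M.fundCircuit f (insert e B) ∩ K ⊆ {e, f} := by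
    rintro x ⟨hx, hxK⟩
    rcases hss hx with h | h | h
    · exact Or.inr h
    · exact Or.inl h
    · exact absurd hxK (hBK _ h)
  have hfm : f ∈ M.fundCircuit f (insert e B) := mem_fundCircuit _ _ _
  refine ⟨_, hc, hss, hle.antisymm (insert_subset ?_ (singleton_subset_iff.2 ⟨hfm, hf⟩))⟩
  refine ⟨by_contra fun h => hc.inter_isCocircuit_ne_singleton hK (e := f) ?_, he⟩
  refine Subset.antisymm (fun x hx => ?_) (singleton_subset_iff.2 ⟨hfm, hf⟩)
  rcases hle hx with rfl | h'
  · exact absurd hx.1 h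
  · exact h'

theorem IsCircuit.exists_isBasis_compl (hX : M.IsCircuit X) (hne : (X ∩ K).Nonempty) :
    ∃ B, M.IsBasis B (M.E \ K) ∧ X ⊆ (X ∩ K) ∪ B := by
  have hI : M.Indep (X \ K) := hX.ssubset_indep (by
    refine sdiff_subset.ssubset_of_ne fun h => ?_
    obtain ⟨x, hx⟩ := hne
    exact (h.ge hx.1).2 hx.2)
  obtain ⟨B, hB, hXB⟩ := hI.subset_isBasis_of_subset
    (sdiff_subset_sdiff_left hX.subset_ground)
  exact ⟨B, hB, fun x hx => by
    by_cases h : x ∈ K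
    · exact Or.inl ⟨hx, h⟩
    · exact Or.inr (hXB ⟨hx, h⟩)⟩

end Cocircuit

/-! ### Matroids from circuit axioms -/

section CircuitAxioms

variable [_root_.Finite α]

theorem exists_of_circuit_axioms (S : Set (Set α)) (hne : ∅ ∉ S)
    (hanti : ∀ K ∈ S, ∀ L ∈ S, K ⊆ L → K = L)
    (helim : ∀ K ∈ S, ∀ L ∈ S, K ≠ L → ∀ e ∈ K ∩ L, ∃ J ∈ S, J ⊆ (K ∪ L) \ {e}) :
    ∃ M : Matroid α, M.E = univ ∧ ∀ K, M.IsCircuit K ↔ K ∈ S := by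
  let Ind : Set α → Prop := fun I => ∀ K ∈ S, ¬ K ⊆ I
  have hsub : ∀ I J, Ind J → I ⊆ J → Ind I := fun I J hJ hIJ K hK h => hJ K hK (h.trans hIJ)
  have haug : ∀ I J, Ind I → Ind J → I.ncard < J.ncard → ∃ e ∈ J, e ∉ I ∧ Ind (insert e I) := by
    intro I J hI hJ hIJ
    by_contra! hcon
    -- Take `L` with `I \ L` as small as possible and `e ∈ I \ L`. Exchanging any `f ∈ L \ I` for
    -- `e` must create a circuit, by minimality. Two such circuits, the second avoiding a point of
    -- the first, are distinct and both contain `e`; eliminating `e` leaves a circuit inside `L`.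
    obtain ⟨L, ⟨hL, hLU, hcard⟩, hmin⟩ := exists_min_image
      {L : Set α | Ind L ∧ L ⊆ I ∪ J ∧ I.ncard < L.ncard} (fun L => (I \ L).ncard) (toFinite _)
      ⟨J, hJ, subset_union_right, hIJ⟩
    have hIL : ¬ I ⊆ L := by
      intro h
      obtain ⟨x, hxL, hxI⟩ := exists_mem_notMem_of_ncard_lt_ncard hcard
      exact hcon x ((hLU hxL).resolve_left hxI) hxI (hsub _ _ hL (insert_subset hxL h))
    obtain ⟨e, heI, heL⟩ := not_subset.1 hIL
    have hcirc : ∀ f ∈ L \ I, ∃ K ∈ S, K ⊆ insert e L \ {f} ∧ e ∈ K := by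
      intro f hf
      have hT : ¬ Ind (insert e L \ {f}) := by
        intro hT
        have hlt := hmin (insert e L \ {f}) ⟨hT, ?_, ?_⟩
        · refine hlt.not_gt (ncard_lt_ncard ?_)
          refine ⟨?_, fun h => ?_⟩
          · rintro x ⟨hxI, hx⟩
            exact ⟨hxI, fun hxL => hx ⟨Or.inr hxL, fun hxf => hf.2 (hxf ▸ hxI)⟩⟩
          · refine (h ⟨heI, heL⟩).2 ⟨Or.inl rfl, ?_⟩
            rintro rfl
            exact heL hf.1
        · exact sdiff_subset.trans (insert_subset (Or.inl heI) hLU)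
        · rwa [ncard_sdiff_singleton_of_mem (mem_insert_of_mem e hf.1), ncard_insert_of_notMem heL]
      simp only [Ind, not_forall, not_not] at hT
      obtain ⟨K, hK, hKT⟩ := hT
      refine ⟨K, hK, hKT, by_contra fun h => hL K hK fun x hx => ?_⟩
      exact (hKT hx).1.resolve_left fun hxe => h (hxe ▸ hx)
    obtain ⟨g, hgL, hgI⟩ := exists_mem_notMem_of_ncard_lt_ncard hcard
    obtain ⟨K, hK, hKT, heK⟩ := hcirc g ⟨hgL, hgI⟩
    obtain ⟨h, hhK, hhI⟩ := not_subset.1 (hI K hK)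
    have hhL : h ∈ L := (hKT hhK).1.resolve_left fun hhe => hhI (hhe ▸ heI)
    obtain ⟨K', hK', hKT', heK'⟩ := hcirc h ⟨hhL, hhI⟩
    obtain ⟨Q, hQ, hQs⟩ := helim K hK K' hK' (fun hEq => (hKT' (hEq ▸ hhK)).2 rfl) e ⟨heK, heK'⟩
    refine hL Q hQ fun x hx => ?_
    rcases (hQs hx).1 with h' | h'
    · exact (hKT h').1.resolve_left (hQs hx).2
    · exact (hKT' h').1.resolve_left (hQs hx).2
  refine ⟨(IndepMatroid.ofFinite (toFinite (univ : Set α)) Ind ?_ (fun I J => hsub I J)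
    (fun I J => haug I J) (fun _ _ => subset_univ _)).matroid, rfl, fun K => ?_⟩
  · intro K hK h
    exact hne (subset_empty_iff.1 h ▸ hK)
  · rw [isCircuit_iff_minimal_not_indep (subset_univ _)]
    have hInd : ∀ I, (IndepMatroid.ofFinite (toFinite (univ : Set α)) Ind
        (fun K hK h => hne (subset_empty_iff.1 h ▸ hK)) (fun I J => hsub I J)
        (fun I J => haug I J) (fun _ _ => subset_univ _)).matroid.Indep I ↔ Ind I :=
      fun I => Iff.rfl
    constructor
    · rintro ⟨h, hmin⟩
      have h' : ¬ Ind K := h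
      simp only [Ind, not_forall, not_not] at h'
      obtain ⟨L, hL, hLK⟩ := h'
      have := hmin (y := L) (fun hi => (hInd L).1 hi L hL subset_rfl) hLK
      rwa [← hLK.antisymm this]
    · intro hK
      refine ⟨fun hi => (hInd K).1 hi K hK subset_rfl, fun L hL hLK => ?_⟩
      have h' : ¬ Ind L := hL
      simp only [Ind, not_forall, not_not] at h'
      obtain ⟨Q, hQ, hQL⟩ := h'
      exact (hanti Q hQ K hK (hQL.trans hLK)) ▸ hQL

end CircuitAxioms

end Matroid

/-! ### Modular pairs and nullity -/

namespace Matroid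

open Set

variable {α : Type*} [_root_.Finite α] {M : Matroid α} {U K L : Set α}

theorem two_le_nul_of_isCircuit (hK : M.IsCircuit K) (hL : M.IsCircuit L) (hne : K ≠ L)
    (hKU : K ⊆ U) (hLU : L ⊆ U) (hU : U ⊆ M.E) : 2 ≤ M.nul U := by
  obtain ⟨x, hxK, hxL⟩ := not_subset.1 fun h => hne (hK.eq_of_subset_isCircuit hL h)
  have h1 := hK.nul_sdiff_singleton hKU hxK hU
  have h2 : M.nul (U \ {x}) ≠ 0 := by
    rw [Ne, nul_eq_zero (sdiff_subset.trans hU)]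
    exact fun h => hL.not_indep (h.subset (subset_sdiff_singleton hLU hxL))
  omega

theorem exists_isCircuit_of_nul_pos (h : 0 < M.nul U) (hU : U ⊆ M.E) :
    ∃ K, K ⊆ U ∧ M.IsCircuit K := by
  refine Dep.exists_isCircuit_subset ⟨fun hI => ?_, hU⟩
  rw [(nul_eq_zero hU).2 hI] at h
  exact h.false

/-- Two distinct circuits force nullity at least 2. If `K ∪ L` has nullity 3 or more, nullity 2
survives the removal of a point, leaving room for two circuits in a smaller union; if it is 2,
removing a point leaves nullity 1. -/
theorem isModularPair_iff (hE : M.E = univ) {S : Set (Set α)}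
    (hS : ∀ K, M.IsCircuit K ↔ K ∈ S) (hK : M.IsCircuit K) (hL : M.IsCircuit L) :
    Tract.IsModularPair S K L ↔ K ≠ L ∧ M.nul (K ∪ L) = 2 := by
  have hsub : ∀ V : Set α, V ⊆ M.E := fun V => by simp [hE]
  constructor
  · rintro ⟨-, -, hne, hmod⟩
    refine ⟨hne, (two_le_nul_of_isCircuit hK hL hne subset_union_left subset_union_right
      (hsub _)).antisymm' ?_⟩
    by_contra! h
    obtain ⟨e, he⟩ := hK.nonempty
    have h1 := hK.nul_sdiff_singleton (U := K ∪ L) subset_union_left he (hsub _)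
    obtain ⟨C, hCU, hC⟩ := exists_isCircuit_of_nul_pos (M := M) (U := (K ∪ L) \ {e}) (by omega)
      (hsub _)
    obtain ⟨y, hy⟩ := hC.nonempty
    have h2 := hC.nul_sdiff_singleton hCU hy (hsub _)
    obtain ⟨C', hCU', hC'⟩ := exists_isCircuit_of_nul_pos (M := M) (U := ((K ∪ L) \ {e}) \ {y})
      (by omega) (hsub _)
    refine hmod ⟨C, (hS C).1 hC, C', (hS C').1 hC', fun h => (hCU' (h ▸ hy)).2 rfl, ?_⟩
    have hss : C ∪ C' ⊆ (K ∪ L) \ {e} := union_subset hCU (hCU'.trans sdiff_subset)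
    exact ⟨hss.trans sdiff_subset, fun h => (hss (h (Or.inl he))).2 rfl⟩
  · rintro ⟨hne, hnul⟩
    refine ⟨(hS K).1 hK, (hS L).1 hL, hne, ?_⟩
    rintro ⟨C, hC, C', hC', hne', hle, hnot⟩
    obtain ⟨z, hz, hzC⟩ := not_subset.1 hnot
    have h1 : M.nul ((K ∪ L) \ {z}) + 1 = M.nul (K ∪ L) := by
      rcases hz with h | h
      · exact hK.nul_sdiff_singleton subset_union_left h (hsub _)
      · exact hL.nul_sdiff_singleton subset_union_right h (hsub _)
    have h2 := two_le_nul_of_isCircuit ((hS C).2 hC) ((hS C').2 hC') hne'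
      (subset_sdiff_singleton (subset_union_left.trans hle) fun h => hzC (Or.inl h))
      (subset_sdiff_singleton (subset_union_right.trans hle) fun h => hzC (Or.inr h)) (hsub _)
    omega

theorem nul_sdiff_insert_range {k : ℕ} {X : Set α} {Y : Fin k → Set α} (hX : M.IsCircuit X)
    (hY : ∀ i, M.IsCircuit (Y i)) (hXU : X ⊆ U) (hYU : ∀ i, Y i ⊆ U) (hU : U ⊆ M.E)
    {e : Fin k → α} (he : ∀ i, e i ∈ Y i) (hne : ∀ i j, j ≠ i → e i ∉ Y j) {x : α} (hx : x ∈ X)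
    (hxY : ∀ i, x ∉ Y i) : M.nul (U \ insert x (range e)) + (k + 1) = M.nul U := by
  rw [← hX.nul_sdiff_singleton hXU hx hU, ← nul_sdiff_range hY
    (fun i => subset_sdiff_singleton (hYU i) (hxY i)) (sdiff_subset.trans hU) he hne,
    sdiff_sdiff, singleton_union]
  ring

end Matroid

/-! ### Signatures, and elimination measured by nullity -/

namespace Tract

open Function Set

variable {G E : Type*} [CommGroup G] {F : Tract G} {τ : F.Involution} {M : Matroid E}
  {C D : Set (E → WithZero G)}

/-- Strong modular elimination of `k` elements at once, with modularity of the family expressed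
by the nullity in the underlying matroid `M`. -/
def ElimAt (F : Tract G) (M : Matroid E) (C : Set (E → WithZero G)) (k : ℕ) : Prop :=
  ∀ (X : E → WithZero G) (Y : Fin k → E → WithZero G), X ∈ C → (∀ i, Y i ∈ C) →
    M.nul (support X ∪ ⋃ i, support (Y i)) = k + 1 →
    ¬ support X ⊆ ⋃ i, support (Y i) →
    ∀ e : Fin k → E,
      (∀ i, e i ∈ support X ∩ support (Y i) ∧ ∀ j, j ≠ i → e i ∉ support (Y j)) →
      (∀ i, X (e i) = F.neg (Y i (e i))) →
      ∃ Z ∈ C, (∀ i, Z (e i) = 0) ∧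
        ∀ f, ∑ i, toSum (Y i f) + toSum (X f) + toSum (F.neg (Z f)) ∈ F.null

section Signature

theorem smul_mem_of_ne_zero (h : ∀ X ∈ C, ∀ α : G, (α : WithZero G) • X ∈ C)
    {X : E → WithZero G} (hX : X ∈ C) {a : WithZero G} (ha : a ≠ 0) : a • X ∈ C := by
  induction a using WithZero.recZeroCoe with
  | zero => exact absurd rfl ha
  | coe g => exact h X hX g

theorem support_smul_of_ne_zero {X : E → WithZero G} {a : WithZero G} (ha : a ≠ 0) :
    support (a • X) = support X := by
  ext e; simp [ha]

theorem IsPreCircuitSet.isSignature (h : IsPreCircuitSet C) (hM : IsUnderlyingMatroid C M) :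
    IsSignature M C where
  zero_notMem := h.zero_notMem
  smul_mem := h.smul_mem
  isCircuit X hX := (hM.2 _).2 ⟨X, hX, rfl⟩
  surjective K hK := (hM.2 K).1 hK
  injective X hX Y hY hXY := h.incomparable X hX Y hY hXY.le

theorem IsSignature.isUnderlyingMatroid (h : IsSignature M C) (hE : M.E = univ) :
    IsUnderlyingMatroid C M :=
  ⟨hE, fun K => ⟨h.surjective K, by rintro ⟨X, hX, rfl⟩; exact h.isCircuit X hX⟩⟩

theorem IsSignature.isPreCircuitSet (h : IsSignature M C) : IsPreCircuitSet C where
  zero_notMem := h.zero_notMem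
  smul_mem := h.smul_mem
  incomparable X hX Y hY hXY := h.injective X hX Y hY
    ((h.isCircuit X hX).eq_of_subset_isCircuit (h.isCircuit Y hY) hXY)

theorem IsSignature.exists_apply_eq (h : IsSignature M C) {K : Set E} (hK : M.IsCircuit K) {e : E}
    (he : e ∈ K) {a : WithZero G} (ha : a ≠ 0) : ∃ X ∈ C, support X = K ∧ X e = a := by
  obtain ⟨X, hX, rfl⟩ := h.surjective K hK
  have hc : a * (X e)⁻¹ ≠ 0 := mul_ne_zero ha (inv_ne_zero he)
  refine ⟨(a * (X e)⁻¹) • X, smul_mem_of_ne_zero h.smul_mem hX hc, support_smul_of_ne_zero hc, ?_⟩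
  simp [inv_mul_cancel_right₀ (show X e ≠ 0 from he)]

theorem iUnion_fin_one (f : Fin 1 → Set E) : ⋃ i, f i = f 0 := by
  ext x; simp

theorem IsSignature.isWeakCircuitSet_iff [Finite E] (h : IsSignature M C) (hE : M.E = univ) :
    F.IsWeakCircuitSet C ↔ ElimAt F M C 1 := by
  have hM := h.isUnderlyingMatroid hE
  constructor
  · intro hw X Y hX hY hnul hnot e he hXe
    rw [iUnion_fin_one] at hnul hnot
    have hmod := (Matroid.isModularPair_iff hE hM.2 (h.isCircuit X hX)
      (h.isCircuit _ (hY 0))).2 ⟨fun h => hnot h.le, hnul⟩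
    obtain ⟨Z, hZ, hZe, hZf⟩ := hw.modular_elimination X hX (Y 0) (hY 0) hmod (e 0) (hXe 0)
      (he 0).1.1
    refine ⟨Z, hZ, fun i => by rw [Subsingleton.elim i 0, hZe], fun f => ?_⟩
    rw [Fin.sum_univ_one, add_comm (toSum (Y 0 f))]
    exact hZf f
  · intro hel
    refine ⟨h.isPreCircuitSet, fun X hX Y hY hmod e hXe hne => ?_⟩
    obtain ⟨hXY, hnul⟩ := (Matroid.isModularPair_iff hE hM.2 (h.isCircuit X hX)
      (h.isCircuit Y hY)).1 hmod
    obtain ⟨Z, hZ, hZe, hZf⟩ := hel X (fun _ => Y) hX (fun _ => hY) (by rwa [iUnion_fin_one])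
      (fun hss => hXY ((h.isCircuit X hX).eq_of_subset_isCircuit (h.isCircuit Y hY)
        (by rwa [iUnion_fin_one] at hss))) (fun _ => e)
      (fun i => ⟨⟨hne, fun h0 => hne (by rw [hXe, h0, F.neg_zero])⟩,
        fun j hj => absurd (Subsingleton.elim _ _) hj⟩) (fun _ => hXe)
    refine ⟨Z, hZ, hZe 0, fun f => ?_⟩
    have := hZf f
    rwa [Fin.sum_univ_one, add_comm (toSum (Y f))] at this

theorem iUnion_cons {k : ℕ} (X : Set E) (Y : Fin k → Set E) :
    ⋃ i, (Fin.cons X Y : Fin (k + 1) → Set E) i = X ∪ ⋃ i, Y i := by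
  ext x; simp

theorem IsSignature.isModularFamily_iff [Finite E] (h : IsSignature M C) (hE : M.E = univ) {k : ℕ}
    {X : E → WithZero G} {Y : Fin k → E → WithZero G} (hX : X ∈ C) (hY : ∀ i, Y i ∈ C) :
    IsModularFamily (supports C)
      (Fin.cons (support X) (fun i => support (Y i)) : Fin (k + 1) → Set E) ↔
    M.nul (support X ∪ ⋃ i, support (Y i)) = k + 1 := by
  have hM := h.isUnderlyingMatroid hE
  have hmem : ∀ i, (Fin.cons (support X) (fun i => support (Y i)) : Fin (k + 1) → Set E) i ∈
      supports C := by
    intro i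
    refine Fin.cases ⟨X, hX, rfl⟩ (fun i => ⟨Y i, hY i, rfl⟩) i
  have hU : ⋃ i, (Fin.cons (support X) (fun i => support (Y i)) : Fin (k + 1) → Set E) i ∈
      unionLattice (supports C) :=
    ⟨range (Fin.cons (support X) (fun i => support (Y i)) : Fin (k + 1) → Set E), by
      rintro _ ⟨i, rfl⟩; exact hmem i, by rw [sUnion_range]⟩
  have hh := Matroid.height_unionLattice hE hM.2 hU
  rw [← iUnion_cons]
  constructor
  · rintro ⟨-, hU', h'⟩
    rw [hh] at h'
    exact_mod_cast h'
  · intro hn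
    refine ⟨hmem, hU, ?_⟩
    rw [hh]
    exact_mod_cast hn

theorem IsSignature.isStrongCircuitSet_iff [Finite E] (h : IsSignature M C) (hE : M.E = univ) :
    F.IsStrongCircuitSet C ↔ ∀ k, ElimAt F M C k := by
  constructor
  · intro hs k X Y hX hY hnul hnot
    exact hs.strong_modular_elimination k X Y hX hY
      ((h.isModularFamily_iff hE hX hY).2 hnul) hnot
  · intro hel
    refine ⟨h.isPreCircuitSet, fun k X Y hX hY hmod hnot => ?_⟩
    exact hel k X Y hX hY ((h.isModularFamily_iff hE hX hY).1 hmod) hnot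

end Signature

/-! ### Orthogonality implies elimination -/

section ElimOfOrthogonal

/-- With `V` the union of the supports, removing the `e i` leaves nullity 1, hence a circuit;
removing also a point `x` of `X` outside all `Y i` leaves an independent set. So this circuit
contains `x`, and `Z` is its vector scaled to agree with `X` at `x`. -/
theorem elimAt_of_orthogonal [Finite E] (hE : M.E = univ) (hC : IsSignature M C)
    (hD : IsSignature M✶ D) {k : ℕ}
    (horth : ∀ X ∈ C, ∀ Y ∈ D, (support X ∩ support Y).ncard ≤ k + 2 → F.Orthogonal τ X Y) :
    ElimAt F M C k := by
  classical
  intro X Y hX hY hnul hnot e he hXe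
  have hsub : ∀ V : Set E, V ⊆ M.E := fun V => by simp [hE]
  have hcirc := fun i => hC.isCircuit (Y i) (hY i)
  have hYV : ∀ i, support (Y i) ⊆ support X ∪ ⋃ i, support (Y i) := fun i =>
    subset_union_of_subset_right (subset_iUnion (fun i => support (Y i)) i) _
  generalize hV : support X ∪ ⋃ i, support (Y i) = V at hnul hYV
  have hXV : support X ⊆ V := hV ▸ subset_union_left
  obtain ⟨x, hxX, hxY⟩ := not_subset.1 hnot
  simp only [mem_iUnion, not_exists] at hxY
  have heY : ∀ i, e i ∈ support (Y i) := fun i => (he i).1.2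
  have hne : ∀ i j, j ≠ i → e i ∉ support (Y j) := fun i j hj => (he i).2 j hj
  have hinj : Injective e := fun i j hij => by
    by_contra h
    exact (he i).2 j (Ne.symm h) (hij ▸ heY j)
  have hxe : ∀ i, e i ≠ x := fun i h => hxY i (h ▸ heY i)
  have h1 := Matroid.nul_sdiff_insert_range (hC.isCircuit X hX) hcirc hXV hYV (hsub V) heY hne
    hxX hxY
  have hind : M.Indep (V \ insert x (range e)) := (Matroid.nul_eq_zero (hsub _)).1 (by omega)
  have h2 := Matroid.nul_sdiff_range hcirc hYV (hsub V) heY hne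
  obtain ⟨K, hKV, hK⟩ := Matroid.exists_isCircuit_of_nul_pos (M := M) (U := V \ range e) (by omega)
    (hsub _)
  have hxK : x ∈ K := by
    by_contra h
    refine hK.not_indep (hind.subset fun y hy => ⟨(hKV hy).1, ?_⟩)
    rintro (rfl | h')
    · exact h hy
    · exact (hKV hy).2 h'
  obtain ⟨Z, hZ, rfl, hZx⟩ := hC.exists_apply_eq hK hxK hxX
  have hZe : ∀ i, Z (e i) = 0 := fun i => by
    by_contra h
    exact (hKV h).2 ⟨i, rfl⟩
  have hYx : ∀ i, Y i x = 0 := fun i => by simpa using hxY i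
  have hYe : ∀ i j, j ≠ i → Y j (e i) = 0 := fun i j hj => by simpa using hne i j hj
  refine ⟨Z, hZ, hZe, fun f => ?_⟩
  by_cases hfV : f ∉ V
  · have hXf : X f = 0 := by
      by_contra h
      exact hfV (hXV h)
    have hYf : ∀ i, Y i f = 0 := fun i => by
      by_contra h
      exact hfV (hYV i h)
    have hZf : Z f = 0 := by
      by_contra h
      exact hfV (hKV h).1
    simpa [hXf, hYf, hZf, F.neg_zero] using F.zero_mem
  rw [not_not] at hfV
  by_cases hfx : f = x
  · subst hfx
    simpa [hYx, hZx] using F.add_mem_iff.2 rfl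
  by_cases hfe : f ∈ range e
  · obtain ⟨j, rfl⟩ := hfe
    rw [Finset.sum_eq_single j (fun i _ hij => by rw [hYe j i hij, map_zero]) (by simp), hZe,
      F.neg_zero, map_zero, add_zero, F.add_mem_iff]
    exact hXe j
  have hfB : f ∈ V \ insert x (range e) := ⟨hfV, by
    rintro (h | h)
    · exact hfx h
    · exact hfe h⟩
  -- This cocircuit meets `V` only in `f`, `x` and the `e i`. Hence `Y i` meets it within `{f, e
  -- i}`, `Z` within `{f, x}`, and `X` in at most `k + 2` elements: all within the range of
  -- orthogonality.
  obtain ⟨L, hL, hLB⟩ := hind.exists_isCocircuit_inter_eq_mem hfB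
  obtain ⟨W, hW, rfl⟩ := hD.surjective L hL
  have hWf : W f ≠ 0 := (hLB.ge rfl).1
  have hVW : ∀ y ∈ V, y ∈ support W → y = f ∨ y = x ∨ y ∈ range e := by
    intro y hy hyW
    by_cases h : y ∈ insert x (range e)
    · exact Or.inr h
    · exact Or.inl (hLB.le ⟨hyW, hy, h⟩)
  have hpair : ∀ a b : E, ({a, b} : Set E).ncard ≤ k + 2 := fun a b =>
    (ncard_insert_le _ _).trans (by simp)
  have hYi : ∀ i, X (e i) * τ.conj (W (e i)) = Y i f * τ.conj (W f) := by
    intro i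
    have hss : support (Y i) ∩ support W ⊆ {f, e i} := by
      rintro y ⟨hy, hyW⟩
      rcases hVW y (hYV i hy) hyW with rfl | rfl | ⟨j, rfl⟩
      · exact Or.inl rfl
      · exact absurd hy (hxY i)
      · rcases eq_or_ne i j with rfl | hij
        · exact Or.inr rfl
        · exact absurd hy (hne j i hij)
    have := (orthogonal_iff_pair (fun h => hfe ⟨i, h.symm⟩) hss).1
      (horth _ (hY i) W hW ((ncard_le_ncard hss).trans (hpair _ _)))
    rw [hXe, F.neg_mul, this, F.neg_neg]
  have hZf : X x * τ.conj (W x) = F.neg (Z f) * τ.conj (W f) := by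
    have hss : support Z ∩ support W ⊆ {f, x} := by
      rintro y ⟨hy, hyW⟩
      rcases hVW y (hKV hy).1 hyW with h | h | h
      · exact Or.inl h
      · exact Or.inr h
      · exact absurd h (hKV hy).2
    have := (orthogonal_iff_pair hfx hss).1
      (horth _ hZ W hW ((ncard_le_ncard hss).trans (hpair _ _)))
    rw [F.neg_mul, ← this, hZx]
  let s : Finset E := insert f (insert x (Finset.univ.image e))
  have hXs : support X ∩ support W ⊆ s := by
    rintro y ⟨hy, hyW⟩
    simpa [s] using hVW y (hXV hy) hyW
  have hcard : (support X ∩ support W).ncard ≤ k + 2 := by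
    refine (ncard_le_ncard hXs).trans ?_
    rw [ncard_coe_finset]
    refine (Finset.card_insert_le _ _).trans (Nat.succ_le_succ ?_)
    refine (Finset.card_insert_le _ _).trans (Nat.succ_le_succ ?_)
    exact Finset.card_image_le.trans (by simp)
  have hsum := (orthogonal_iff_sum s hXs).1 (horth X hX W hW hcard)
  have hf1 : f ∉ insert x (Finset.univ.image e) := by
    simp only [Finset.mem_insert, Finset.mem_image, Finset.mem_univ, true_and, not_or]
    exact ⟨hfx, hfe⟩
  have hx1 : x ∉ Finset.univ.image e := by
    simpa using hxe
  rw [Finset.sum_insert hf1, Finset.sum_insert hx1, Finset.sum_image hinj.injOn, hZf] at hsum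
  simp_rw [hYi] at hsum
  -- After the two-term relations are substituted, `X ⊥ W` is the desired relation at `f` multiplied
  -- by the nonzero `τ.conj (W f)`.
  rw [← F.toSum_mul_mem_iff ((τ.conj_eq_zero).not.2 hWf)]
  convert hsum using 1
  simp only [map_mul, ← Finset.sum_mul]
  ring

end ElimOfOrthogonal
end Tract

namespace Tract

open Function Set

variable {G E : Type*} [CommGroup G] {F : Tract G} {τ : F.Involution} {M : Matroid E}
  {C D : Set (E → WithZero G)}

/-! ### Elimination implies orthogonality -/

section OrthogonalOfElim

theorem subset_union_of_sum_mem {k : ℕ} {X Z : E → WithZero G} {Y : Fin k → E → WithZero G}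
    (h : ∀ f, ∑ i, toSum (Y i f) + toSum (X f) + toSum (F.neg (Z f)) ∈ F.null) :
    support Z ⊆ support X ∪ ⋃ i, support (Y i) := by
  intro f hf
  by_contra hfV
  simp only [mem_union, mem_iUnion, mem_support, not_or, not_exists, not_not] at hfV
  have := h f
  simp only [hfV, map_zero, Finset.sum_const_zero, zero_add, F.toSum_mem_iff,
    F.neg_eq_zero] at this
  exact hf this

/-- Fix two common elements `a`, `b`. Each of the other `k` common elements `e i` is eliminated from
`X` by a circuit vector `W i` meeting the cocircuit in `{a, e i}`. The result `Z` meets it within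
`{a, b}`, so only orthogonality with at most two common elements is needed. -/
theorem orthogonal_of_elimAt [Finite E] (hE : M.E = univ) (hC : IsSignature M C)
    {Y : E → WithZero G} (hY : M.IsCocircuit (support Y))
    (horth : ∀ X ∈ C, (support X ∩ support Y).ncard ≤ 2 → F.Orthogonal τ X Y) {k : ℕ}
    (hel : ElimAt F M C k) {X : E → WithZero G} (hX : X ∈ C)
    (hcard : (support X ∩ support Y).ncard = k + 2) : F.Orthogonal τ X Y := by
  classical
  have hsub : ∀ V : Set E, V ⊆ M.E := fun V => by simp [hE]
  generalize hT : support X ∩ support Y = T at hcard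
  obtain ⟨a, ha, b, hb, hab⟩ := (one_lt_ncard (s := T)).1 (by omega)
  have haY : a ∈ support Y := (hT.ge ha).2
  have hbX : b ∈ support X := (hT.ge hb).1
  have hT' : (T \ {a, b}).ncard = k := by
    rw [ncard_sdiff (insert_subset ha (singleton_subset_iff.2 hb)), ncard_pair hab, hcard]
    omega
  let e' : Fin k ≃ ↥(T \ {a, b}) := (Finite.equivFinOfCardEq hT').symm
  obtain ⟨e, he⟩ : ∃ e : Fin k → E, e = fun i => (e' i : E) := ⟨_, rfl⟩
  have hinj : Injective e := by rw [he]; exact Subtype.val_injective.comp e'.injective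
  have hran : range e = T \ {a, b} := by
    rw [he]
    exact (e'.surjective.range_comp Subtype.val).trans Subtype.range_coe
  have heT : ∀ i, e i ∈ T \ {a, b} := fun i => hran ▸ mem_range_self i
  have hea : ∀ i, e i ≠ a := fun i h => (heT i).2 (Or.inl h)
  have heb : ∀ i, e i ≠ b := fun i h => (heT i).2 (Or.inr h)
  have heX : ∀ i, e i ∈ support X := fun i => (hT.ge (heT i).1).1
  have heY : ∀ i, e i ∈ support Y := fun i => (hT.ge (heT i).1).2
  -- Choosing `B` to contain the part of `X` off the cocircuit puts every circuit involved in the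
  -- base `insert a B` together with `b` and the `e i`. This caps the nullity at `k + 1`, as
  -- modularity requires.
  obtain ⟨B, hB, hXB⟩ := (hC.isCircuit X hX).exists_isBasis_compl (K := support Y)
    (hT ▸ ⟨a, ha⟩)
  have hBY : ∀ x ∈ B, x ∉ support Y := fun x hx => (hB.subset hx).2
  have hex : ∀ i, ∃ W ∈ C, support W ⊆ insert (e i) (insert a B) ∧
      support W ∩ support Y = {a, e i} ∧ W (e i) = F.neg (X (e i)) := by
    intro i
    obtain ⟨K, hK, hKB, hKY⟩ := hY.exists_isCircuit_inter_eq_pair hB haY (heY i) (hea i).symm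
    obtain ⟨W, hW, rfl, hWe⟩ := hC.exists_apply_eq hK (hKY.ge (Or.inr rfl)).1
      (F.neg_eq_zero.not.2 (heX i))
    exact ⟨W, hW, hKB, hKY, hWe⟩
  choose W hW hWB hWY hWe using hex
  have hWiff : ∀ i, ∀ x ∈ support Y, x ∈ support (W i) → x = a ∨ x = e i := fun i x hx h =>
    (hWY i).le ⟨h, hx⟩
  have heW : ∀ i, e i ∈ support (W i) := fun i => ((hWY i).ge (Or.inr rfl)).1
  have hne : ∀ i j, j ≠ i → e i ∉ support (W j) := fun i j hj h =>
    (hWiff j _ (heY i) h).elim (hea i) fun h' => hj (hinj h').symm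
  have hbW : ∀ i, b ∉ support (W i) := fun i h =>
    (hWiff i b (hT.ge hb).2 h).elim hab.symm (heb i).symm
  have hWV : ∀ i, support (W i) ⊆ support X ∪ ⋃ i, support (W i) := fun i =>
    subset_union_of_subset_right (subset_iUnion (fun i => support (W i)) i) _
  have h1 := Matroid.nul_sdiff_insert_range (hC.isCircuit X hX) (fun i => hC.isCircuit _ (hW i))
    subset_union_left hWV (hsub _) heW hne hbX hbW
  have h2 : M.nul (support X ∪ ⋃ i, support (W i)) ≤ k + 1 := by
    refine ((hY.isBase_insert hB haY).indep.nul_union_le (insert b (range e)) (hsub _) ?_).trans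
      ((ncard_insert_le _ _).trans ?_)
    · have hTs : T ⊆ insert a B ∪ insert b (range e) := fun x hx => by
        by_cases h : x ∈ ({a, b} : Set E)
        · rcases h with rfl | rfl
          · exact Or.inl (Or.inl rfl)
          · exact Or.inr (Or.inl rfl)
        · exact Or.inr (Or.inr (hran ▸ ⟨hx, h⟩))
      refine union_subset (fun x hx => ?_) (iUnion_subset fun i x hx => ?_)
      · rcases hXB hx with h | h
        · exact hTs (hT ▸ h)
        · exact Or.inl (Or.inr h)
      · rcases hWB i hx with h | h
        · exact Or.inr (Or.inr ⟨i, h.symm⟩)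
        · exact Or.inl h
    · rw [hran, hT']
  obtain ⟨Z, hZ, hZe, hZs⟩ := hel X W hX hW (by omega)
    (fun h => by simpa using (h.trans (iUnion_subset fun i => subset_compl_singleton_iff.2 (hbW i))) hbX)
    e (fun i => ⟨⟨heX i, heW i⟩, hne i⟩) (fun i => by rw [hWe, F.neg_neg])
  have hZY : support Z ∩ support Y ⊆ {a, b} := by
    rintro x ⟨hx, hxY⟩
    by_contra hxab
    have hxe : x ∉ range e := by
      rintro ⟨i, rfl⟩
      exact hx (hZe i)
    rcases subset_union_of_sum_mem hZs hx with h | h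
    · exact hxe (hran ▸ ⟨hT ▸ ⟨h, hxY⟩, hxab⟩)
    · obtain ⟨i, hi⟩ := mem_iUnion.1 h
      rcases hWiff i x hxY hi with h' | h'
      · exact hxab (Or.inl h')
      · exact hxe ⟨i, h'.symm⟩
  have hZorth := (orthogonal_iff_pair hab hZY).1 (horth Z hZ ((ncard_le_ncard hZY).trans
    (ncard_pair hab).le))
  have hWb : ∀ i, W i b = 0 := fun i => by simpa using hbW i
  have hZb : X b = Z b := by
    have := hZs b
    simp only [hWb, map_zero, Finset.sum_const_zero, zero_add, F.add_mem_iff] at this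
    rw [← F.neg_neg (X b), ← this, F.neg_neg]
  have hXe : ∀ i, X (e i) * τ.conj (Y (e i)) = W i a * τ.conj (Y a) := by
    intro i
    have := (orthogonal_iff_pair (hea i).symm (hWY i).le).1 (horth _ (hW i) (by
      rw [hWY i]; exact (ncard_pair (hea i).symm).le))
    rw [hWe, F.neg_mul] at this
    rw [← F.neg_neg (X (e i) * _), this, F.neg_neg]
  have hTs : support X ∩ support Y ⊆ (insert a (insert b (Finset.univ.image e)) : Finset E) := by
    rw [hT]
    intro x hx
    by_cases h : x ∈ ({a, b} : Set E)
    · rcases h with rfl | rfl <;> simp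
    · have : x ∈ range e := hran ▸ ⟨hx, h⟩
      simpa using Or.inr (Or.inr this)
  rw [orthogonal_iff_sum _ hTs, Finset.sum_insert, Finset.sum_insert, Finset.sum_image hinj.injOn,
    hZb, hZorth]
  · simp_rw [hXe]
    -- The elimination relation at `a`, multiplied by `τ.conj (Y a)`, is the inner product of `X`
    -- and `Y`: the `W i` terms give the values at `e i`, and the `Z` term gives the value at `b`.
    convert F.toSum_mul_mem (τ.conj (Y a)) (hZs a) using 1
    rw [← F.neg_mul]
    simp only [map_mul, ← Finset.sum_mul]
    ring
  · simpa using heb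
  · simpa [hab] using hea

end OrthogonalOfElim

/-! ### Uniqueness of cocircuit vectors up to scalars -/

section Proportional

/-- Any two elements of the cocircuit are cut out by some circuit, and orthogonality to its vector
forces the ratio of the two values. -/
theorem IsSignature.exists_smul_eq_of_orthogonal [Finite E] (hE : M.E = univ)
    (hC : IsSignature M C) {Y Y' : E → WithZero G}
    (hY : M.IsCocircuit (support Y)) (hYY : support Y = support Y')
    (h : ∀ X ∈ C, (support X ∩ support Y).ncard ≤ 2 → F.Orthogonal τ X Y)
    (h' : ∀ X ∈ C, (support X ∩ support Y').ncard ≤ 2 → F.Orthogonal τ X Y') :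
    ∃ α : G, Y = (α : WithZero G) • Y' := by
  obtain ⟨e, he⟩ := hY.nonempty
  have he' : Y' e ≠ 0 := hYY.le he
  have hα : Y e / Y' e ≠ 0 := div_ne_zero he he'
  suffices hs : Y = (Y e / Y' e) • Y' from
    ⟨WithZero.unzero hα, by rw [WithZero.coe_unzero]; exact hs⟩
  obtain ⟨B, hB⟩ := M.exists_isBasis (M.E \ support Y)
  funext f
  rcases eq_or_ne e f with rfl | hef
  · simp [div_mul_cancel₀ _ he']
  by_cases hf : f ∈ support Y
  swap
  · have hf' := hf
    rw [hYY] at hf'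
    rw [notMem_support] at hf hf'
    simp [hf, hf']
  obtain ⟨K, hK, -, hKY⟩ := hY.exists_isCircuit_inter_eq_pair hB he hf hef
  obtain ⟨X, hX, rfl⟩ := hC.surjective K hK
  have h1 := (orthogonal_iff_pair hef hKY.le).1 (h X hX (by rw [hKY, ncard_pair hef]))
  rw [hYY] at hKY
  have h2 := (orthogonal_iff_pair hef hKY.le).1 (h' X hX (by rw [hKY, ncard_pair hef]))
  have hXe : X e ≠ 0 := (hKY.ge (Or.inl rfl)).1
  have hXf : X f ≠ 0 := (hKY.ge (Or.inr rfl)).1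
  have key : τ.conj (Y f) * τ.conj (Y' e) = τ.conj (Y e) * τ.conj (Y' f) := by
    refine mul_left_cancel₀ (mul_ne_zero hXe hXf) ?_
    calc X e * X f * (τ.conj (Y f) * τ.conj (Y' e))
        = (X f * τ.conj (Y f)) * (X e * τ.conj (Y' e)) := by
          rw [mul_comm (X e) (X f), mul_mul_mul_comm]
      _ = (X e * τ.conj (Y e)) * (X f * τ.conj (Y' f)) := by
          rw [h1, h2, F.neg_mul, F.mul_neg]
      _ = _ := by rw [mul_mul_mul_comm]
  rw [← map_mul, ← map_mul] at key
  have key' := congrArg τ.conj key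
  rw [τ.conj_conj, τ.conj_conj] at key'
  show Y f = Y e / Y' e * Y' f
  rw [div_mul_eq_mul_div, ← key', mul_div_cancel_right₀ _ he']

end Proportional

/-! ### Construction of cocircuit vectors -/

section Cosignature

variable [Finite E]

/-- Elimination for pairs of vectors whose supports have a union of nullity at most two. -/
theorem ElimAt.pair (hE : M.E = univ) (hC : IsSignature M C) (hel : ElimAt F M C 1)
    {X Y : E → WithZero G} (hX : X ∈ C) (hY : Y ∈ C) (hne : support X ≠ support Y)
    (hnul : M.nul (support X ∪ support Y) ≤ 2) {e : E} (he : X e = F.neg (Y e)) (hXe : X e ≠ 0) :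
    ∃ Z ∈ C, Z e = 0 ∧ support Z ⊆ support X ∪ support Y ∧
      ∀ f, toSum (Y f) + toSum (X f) + toSum (F.neg (Z f)) ∈ F.null := by
  have h2 := Matroid.two_le_nul_of_isCircuit (hC.isCircuit X hX) (hC.isCircuit Y hY) hne
    (subset_union_left (t := support Y)) subset_union_right (by simp [hE])
  obtain ⟨Z, hZ, hZe, hZf⟩ := hel X (fun _ => Y) hX (fun _ => hY)
    (by rw [iUnion_fin_one]; omega)
    (fun hss => hne ((hC.isCircuit X hX).eq_of_subset_isCircuit (hC.isCircuit Y hY)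
      (by rwa [iUnion_fin_one] at hss))) (fun _ => e)
    (fun i => ⟨⟨hXe, fun h0 => hXe (by rw [he, h0, F.neg_zero])⟩,
      fun j hj => absurd (Subsingleton.elim _ _) hj⟩) (fun _ => he)
  refine ⟨Z, hZ, hZe 0, by simpa [iUnion_fin_one] using subset_union_of_sum_mem hZf, fun f => ?_⟩
  simpa using hZf f

variable {K : Set E} {e f : E}

/-- Eliminating `f` between `X` and a multiple of `Y` gives a circuit vector that could meet `K`
only in `e`, so it vanishes at `e` as well; the relation at `e` is then the equality of ratios. -/
theorem cross_eq_of_nul_le (hE : M.E = univ) (hC : IsSignature M C) (hel : ElimAt F M C 1)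
    (hK : M.IsCocircuit K) (hef : e ≠ f) {X Y : E → WithZero G} (hX : X ∈ C) (hY : Y ∈ C)
    (hXK : support X ∩ K = {e, f}) (hYK : support Y ∩ K = {e, f})
    (hnul : M.nul (support X ∪ support Y) ≤ 2) : X e * Y f = Y e * X f := by
  by_cases hne : support X = support Y
  · obtain ⟨α, rfl⟩ := hC.injective X hX Y hY hne
    simp only [Pi.smul_apply, smul_eq_mul]
    rw [mul_right_comm, mul_comm]
  have hXf : X f ≠ 0 := (hXK.ge (Or.inr rfl)).1
  have hYf : Y f ≠ 0 := (hYK.ge (Or.inr rfl)).1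
  have hα : F.neg (X f / Y f) ≠ 0 := F.neg_eq_zero.not.2 (div_ne_zero hXf hYf)
  have hsupp : support (F.neg (X f / Y f) • Y) = support Y := support_smul_of_ne_zero hα
  obtain ⟨Z, hZ, hZf, hZs, hZN⟩ := hel.pair hE hC hX (smul_mem_of_ne_zero hC.smul_mem hY hα)
    (by rwa [hsupp]) (by rwa [hsupp]) (e := f)
    (by simp [F.neg_mul, F.neg_neg, div_mul_cancel₀ _ hYf]) hXf
  rw [hsupp] at hZs
  have hZK : support Z ∩ K ⊆ {e} := by
    rintro x ⟨hx, hxK⟩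
    have : x ∈ ({e, f} : Set E) := by
      rcases hZs hx with h | h
      · exact hXK.le ⟨h, hxK⟩
      · exact hYK.le ⟨h, hxK⟩
    refine this.resolve_right ?_
    rintro rfl
    exact hx hZf
  have hZe : Z e = 0 := by
    by_contra h
    refine (hC.isCircuit Z hZ).inter_isCocircuit_ne_singleton hK (e := e) (hZK.antisymm ?_)
    exact singleton_subset_iff.2 ⟨h, (hXK.ge (Or.inl rfl)).2⟩
  have := hZN e
  simp only [hZe, F.neg_zero, map_zero, add_zero, F.add_mem_iff, Pi.smul_apply, smul_eq_mul,
    F.neg_mul, F.neg_neg] at this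
  rw [this, div_mul_eq_mul_div, div_mul_cancel₀ _ hYf, mul_comm]

/-- Induction on the exchange distance between `A` and `B`: an intermediate circuit vector, one
exchange away from `A`, links `X` to `Y`. -/
theorem cross_eq_of_isBasis (hE : M.E = univ) (hC : IsSignature M C) (hel : ElimAt F M C 1)
    (hK : M.IsCocircuit K) (hef : e ≠ f) (n : ℕ) {A B : Set E} (hA : M.IsBasis A (M.E \ K))
    (hB : M.IsBasis B (M.E \ K)) (hn : (A \ B).ncard = n) {X Y : E → WithZero G}
    (hX : X ∈ C) (hY : Y ∈ C) (hXK : support X ∩ K = {e, f}) (hYK : support Y ∩ K = {e, f})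
    (hXA : support X ⊆ insert f (insert e A)) (hYB : support Y ⊆ insert f (insert e B)) :
    X e * Y f = Y e * X f := by
  have hsub : ∀ V : Set E, V ⊆ M.E := fun V => by simp [hE]
  have heK : e ∈ K := (hXK.ge (Or.inl rfl)).2
  have hfK : f ∈ K := (hXK.ge (Or.inr rfl)).2
  have hAe := (hK.isBase_insert hA heK).indep
  induction n generalizing A X with
  | zero =>
    rw [ncard_eq_zero, sdiff_eq_empty] at hn
    have hAB := hA.eq_of_subset_indep hB.indep hn hB.subset
    subst hAB
    refine cross_eq_of_nul_le hE hC hel hK hef hX hY hXK hYK ?_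
    refine (hAe.nul_union_le {f} (hsub _) ?_).trans (by simp)
    rw [union_singleton]
    exact union_subset hXA hYB
  | succ n ih =>
    have hne : (A \ B).Nonempty := by
      rw [nonempty_iff_ne_empty]
      intro h
      simp [h] at hn
    obtain ⟨x, hx⟩ := hne
    obtain ⟨y, hy, hA'⟩ := hA.isBase_restrict.exchange hB.isBase_restrict hx
    rw [Matroid.isBase_restrict_iff] at hA'
    have hn' : (insert y (A \ {x}) \ B).ncard = n := by
      have : insert y (A \ {x}) \ B = (A \ B) \ {x} := by
        rw [insert_sdiff_of_mem _ hy.1, sdiff_sdiff_comm]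
      rw [this, ncard_sdiff_singleton_of_mem hx, hn]
      rfl
    obtain ⟨L, hL, hLA, hLK⟩ := hK.exists_isCircuit_inter_eq_pair hA' heK hfK hef
    obtain ⟨Z, hZ, rfl⟩ := hC.surjective L hL
    have h1 := ih hA' hn' hZ hLK hLA (hK.isBase_insert hA' heK).indep
    -- One exchange adds only `y`: both supports lie in the independent set `insert e A` together
    -- with `f` and `y`, so the union has nullity at most 2.
    have h2 : X e * Z f = Z e * X f := by
      refine cross_eq_of_nul_le hE hC hel hK hef hX hZ hXK hLK ?_
      refine (hAe.nul_union_le {f, y} (hsub _) ?_).trans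
        ((ncard_insert_le _ _).trans (by simp))
      refine union_subset (hXA.trans ?_) (hLA.trans ?_)
      · exact insert_subset (Or.inr (Or.inl rfl)) subset_union_left
      · refine insert_subset (Or.inr (Or.inl rfl)) (insert_subset (Or.inl (Or.inl rfl)) ?_)
        refine insert_subset (Or.inr (Or.inr rfl)) fun z hz => Or.inl (Or.inr hz.1)
    have hZe : Z e ≠ 0 := (hLK.ge (Or.inl rfl)).1
    refine mul_left_cancel₀ hZe ?_
    calc Z e * (X e * Y f) = X e * (Z e * Y f) := mul_left_comm _ _ _
      _ = Y e * (X e * Z f) := by rw [h1, mul_left_comm]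
      _ = Z e * (Y e * X f) := by rw [h2, mul_left_comm]

theorem cross_eq (hE : M.E = univ) (hC : IsSignature M C) (hel : ElimAt F M C 1)
    (hK : M.IsCocircuit K) (hef : e ≠ f) {X Y : E → WithZero G}
    (hX : X ∈ C) (hY : Y ∈ C) (hXK : support X ∩ K = {e, f}) (hYK : support Y ∩ K = {e, f}) :
    X e * Y f = Y e * X f := by
  have key : ∀ Z ∈ C, support Z ∩ K = {e, f} →
      ∃ B, M.IsBasis B (M.E \ K) ∧ support Z ⊆ insert f (insert e B) := by
    intro Z hZ hZK
    obtain ⟨B, hB, hZB⟩ := (hC.isCircuit Z hZ).exists_isBasis_compl (K := K)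
      (hZK ▸ insert_nonempty _ _)
    refine ⟨B, hB, hZB.trans ?_⟩
    rw [hZK]
    rintro x ((rfl | rfl) | h)
    · exact Or.inr (Or.inl rfl)
    · exact Or.inl rfl
    · exact Or.inr (Or.inr h)
  obtain ⟨A, hA, hXA⟩ := key X hX hXK
  obtain ⟨B, hB, hYB⟩ := key Y hY hYK
  exact cross_eq_of_isBasis hE hC hel hK hef _ hA hB rfl hX hY hXK hYK hXA hYB

/-- Values are fixed by a reference point `o` and circuit vectors `W f` meeting `K` in `{o, f}`;
`cross_eq` shows that every other circuit with two elements in `K` gives the same ratios. -/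
theorem exists_orthogonal_of_isCocircuit (hE : M.E = univ) (hC : IsSignature M C)
    (hel : ElimAt F M C 1) (τ : F.Involution) (hK : M.IsCocircuit K) :
    ∃ Y : E → WithZero G, support Y = K ∧
      ∀ X ∈ C, (support X ∩ support Y).ncard ≤ 2 → F.Orthogonal τ X Y := by
  classical
  have hsub : ∀ V : Set E, V ⊆ M.E := fun V => by simp [hE]
  obtain ⟨o, ho⟩ := hK.nonempty
  obtain ⟨B, hB⟩ := M.exists_isBasis (M.E \ K)
  have hex : ∀ f, ∃ W : E → WithZero G, f ∈ K → o ≠ f → W ∈ C ∧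
      support W ⊆ insert f (insert o B) ∧ support W ∩ K = {o, f} ∧ W o = 1 := by
    intro f
    by_cases h : f ∈ K ∧ o ≠ f
    · obtain ⟨L, hL, hLB, hLK⟩ := hK.exists_isCircuit_inter_eq_pair hB ho h.1 h.2
      obtain ⟨W, hW, rfl, hWo⟩ := hC.exists_apply_eq hL (hLK.ge (Or.inl rfl)).1 one_ne_zero
      exact ⟨W, fun _ _ => ⟨hW, hLB, hLK, hWo⟩⟩
    · exact ⟨0, fun h1 h2 => absurd ⟨h1, h2⟩ h⟩
  choose W hW using hex
  have hWf : ∀ f ∈ K, o ≠ f → W f f ≠ 0 := fun f hf hof =>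
    ((hW f hf hof).2.2.1.ge (Or.inr rfl)).1
  obtain ⟨c, hc⟩ : ∃ c : E → WithZero G, c = fun f =>
    if f = o then 1 else if f ∈ K then F.neg (W f f)⁻¹ else 0 := ⟨_, rfl⟩
  have hco : c o = 1 := by rw [hc]; simp
  have hcf : ∀ f ∈ K, o ≠ f → c f = F.neg (W f f)⁻¹ := fun f hf hof => by
    rw [hc]; simp [hf, hof.symm]
  have hc0 : ∀ f, f ∉ K → c f = 0 := fun f hf => by
    have : f ≠ o := fun h => hf (h ▸ ho)
    rw [hc]; simp [hf, this]
  have hsupp : support (fun f => τ.conj (c f)) = K := by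
    ext f
    rw [mem_support, Ne, τ.conj_eq_zero]
    by_cases hf : f ∈ K
    · rcases eq_or_ne o f with rfl | hof
      · simp [hf, hco]
      · simp [hf, hcf f hf hof, F.neg_eq_zero, hWf f hf hof]
    · simp [hf, hc0 f hf]
  refine ⟨fun f => τ.conj (c f), hsupp, fun X hX hcard => ?_⟩
  have hbase : ∀ f, o ≠ f → support X ∩ K = {o, f} → X f * c f = F.neg (X o * c o) := by
    intro f hof hXK
    have hf : f ∈ K := (hXK.ge (Or.inr rfl)).2
    obtain ⟨hWC, -, hWK, hWo⟩ := hW f hf hof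
    have := cross_eq hE hC hel hK hof hX hWC hXK hWK
    rw [hWo, one_mul] at this
    rw [hco, hcf f hf hof, mul_one, F.mul_neg, ← this, mul_inv_cancel_right₀ (hWf f hf hof)]
  rw [hsupp] at hcard
  rcases eq_empty_or_nonempty (support X ∩ K) with h0 | hne
  · exact orthogonal_of_disjoint (by rw [hsupp, h0])
  obtain ⟨e, he⟩ := hne
  have hpair : ∃ f, e ≠ f ∧ support X ∩ K = {e, f} := by
    have h1 : (support X ∩ K).ncard ≠ 1 := fun h => by
      obtain ⟨x, hx⟩ := ncard_eq_one.1 h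
      exact (hC.isCircuit X hX).inter_isCocircuit_ne_singleton hK hx
    have h2 : (support X ∩ K).ncard ≠ 0 := ((ncard_pos (toFinite _)).2 ⟨e, he⟩).ne'
    obtain ⟨x, y, hxy, hs⟩ := ncard_eq_two.1 (show (support X ∩ K).ncard = 2 by omega)
    rw [hs] at he
    rcases he with rfl | rfl
    · exact ⟨y, hxy, hs⟩
    · exact ⟨x, hxy.symm, by rw [hs, pair_comm]⟩
  obtain ⟨f, hef, hXK⟩ := hpair
  rw [orthogonal_iff_pair hef (by rw [hsupp, hXK]), τ.conj_conj, τ.conj_conj]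
  rcases eq_or_ne o e with rfl | hoe
  · exact hbase f hef hXK
  rcases eq_or_ne o f with rfl | hof
  · rw [← F.eq_neg_comm]
    exact hbase e hoe (by rw [hXK, pair_comm])
  have heK : e ∈ K := (hXK.ge (Or.inl rfl)).2
  have hfK : f ∈ K := (hXK.ge (Or.inr rfl)).2
  obtain ⟨heC, heB, heWK, heo⟩ := hW e heK hoe
  obtain ⟨hfC, hfB, hfWK, hfo⟩ := hW f hfK hof
  have hWef : W e f = 0 := by
    by_contra h
    rcases heWK.le ⟨h, hfK⟩ with h | h
    · exact hof h.symm
    · exact hef h.symm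
  have hWfe : W f e = 0 := by
    by_contra h
    rcases hfWK.le ⟨h, heK⟩ with h | h
    · exact hoe h.symm
    · exact hef h
  have hα : F.neg 1 ≠ 0 := F.neg_eq_zero.not.2 one_ne_zero
  have hs : support (F.neg 1 • W f) = support (W f) := support_smul_of_ne_zero hα
  -- When `X` misses `o`, eliminating `o` between `W e` and `-W f` gives a vector meeting `K` in
  -- `{e, f}` with values `W e e` and `-W f f`; comparing `X` with it gives the ratio needed.
  obtain ⟨Z, hZ, hZo, hZs, hZN⟩ := hel.pair hE hC heC (smul_mem_of_ne_zero hC.smul_mem hfC hα)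
    (by rw [hs]; exact fun h => (h.symm.le (hWf f hfK hof)) hWef)
    (by
      rw [hs]
      refine ((hK.isBase_insert hB ho).indep.nul_union_le {e, f} (hsub _) ?_).trans
        ((ncard_insert_le _ _).trans (by simp))
      refine union_subset (heB.trans ?_) (hfB.trans ?_)
      · exact insert_subset (Or.inr (Or.inl rfl)) subset_union_left
      · exact insert_subset (Or.inr (Or.inr rfl)) subset_union_left) (e := o)
    (by simp [heo, hfo, F.neg_mul, F.neg_neg]) (by rw [heo]; exact one_ne_zero)
  rw [hs] at hZs
  have hZe : Z e = W e e := by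
    have := hZN e
    simp only [Pi.smul_apply, smul_eq_mul, hWfe, mul_zero, map_zero, zero_add,
      F.add_mem_iff] at this
    rw [← F.neg_neg (Z e), this, F.neg_neg]
  have hZf : Z f = F.neg (W f f) := by
    have := hZN f
    simp only [Pi.smul_apply, smul_eq_mul, hWef, map_zero, add_zero, F.add_mem_iff, F.neg_mul,
      one_mul, F.neg_neg] at this
    rw [← F.neg_neg (Z f), this]
  have hZK : support Z ∩ K = {e, f} := by
    refine Subset.antisymm ?_ (insert_subset ⟨?_, heK⟩ (singleton_subset_iff.2 ⟨?_, hfK⟩))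
    · rintro x ⟨hx, hxK⟩
      have hxo : x ≠ o := fun h => hx (h ▸ hZo)
      rcases hZs hx with h | h
      · exact Or.inl ((heWK.le ⟨h, hxK⟩).resolve_left hxo)
      · exact Or.inr ((hfWK.le ⟨h, hxK⟩).resolve_left hxo)
    · rw [mem_support, hZe]
      exact hWf e heK hoe
    · rw [mem_support, hZf]
      exact F.neg_eq_zero.not.2 (hWf f hfK hof)
  have := cross_eq hE hC hel hK hef hX hZ hXK hZK
  rw [hZe, hZf, F.mul_neg] at this
  have hwe := hWf e heK hoe
  have hwf := hWf f hfK hof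
  rw [hcf f hfK hof, hcf e heK hoe, F.mul_neg, F.mul_neg, F.neg_neg, ← F.neg_mul,
    ← div_eq_mul_inv, ← div_eq_mul_inv, eq_comm, div_eq_div_iff hwe hwf, F.neg_mul, mul_comm (X f),
    ← this, F.neg_neg]

end Cosignature
end Tract

/-! ### Minors on the subtype of the complement -/

namespace Matroid

open Set

variable {α : Type*} {M : Matroid α} {A : Set α}

theorem restrictSubtype_isCircuit_iff {X : Set α} (hX : X ⊆ M.E) {K : Set X} :
    (M.restrictSubtype X).IsCircuit K ↔ M.IsCircuit ((↑) '' K) := by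
  have hK : ((↑) '' K : Set α) ⊆ M.E := (Subtype.coe_image_subset X K).trans hX
  rw [isCircuit_iff_dep_forall_sdiff_singleton_indep,
    isCircuit_iff_dep_forall_sdiff_singleton_indep, ← not_indep_iff, ← not_indep_iff,
    restrictSubtype_indep_iff]
  refine and_congr_right fun _ => ?_
  rw [forall_mem_image]
  refine forall₂_congr fun e _ => ?_
  rw [restrictSubtype_indep_iff, image_sdiff Subtype.val_injective, image_singleton]

theorem restrictSubtype_contract_dual (hE : M.E = univ) :
    ((M ／ A).restrictSubtype Aᶜ)✶ = (M✶ ＼ A).restrictSubtype Aᶜ := by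
  rw [restrictSubtype_dual' (by simp [hE, compl_eq_univ_sdiff]), dual_contract]

theorem restrictSubtype_delete_isCircuit_iff (hE : M.E = univ) {K : Set ↥Aᶜ} :
    ((M ＼ A).restrictSubtype Aᶜ).IsCircuit K ↔ M.IsCircuit ((↑) '' K) := by
  rw [restrictSubtype_isCircuit_iff (by simp [hE, compl_eq_univ_sdiff]), delete_isCircuit_iff]
  refine and_iff_left (disjoint_left.2 ?_)
  rintro _ ⟨x, _, rfl⟩
  exact x.2

end Matroid

/-! ### Dual pairs and the dual circuit set -/

namespace Tract

open Function Set
open scoped Matroid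

variable {G E : Type*} [CommGroup G] {F : Tract G} {τ : F.Involution} {M : Matroid E}
  {C D : Set (E → WithZero G)} {A : Set E} {m : ℕ∞}

/-- A pair of `F`-signatures of `M` and its dual such that members whose supports have at most `m`
common elements are orthogonal. -/
structure IsDualPair (F : Tract G) (τ : F.Involution) (M : Matroid E)
    (C D : Set (E → WithZero G)) (m : ℕ∞) : Prop where
  ground : M.E = Set.univ
  left : IsSignature M C
  right : IsSignature M✶ D
  orthogonal : ∀ X ∈ C, ∀ Y ∈ D, (support X ∩ support Y).encard ≤ m → F.Orthogonal τ X Y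

section DualPair

theorem IsUnderlyingMatroid.unique {G : Type*} {C : Set (E → WithZero G)} {N : Matroid E}
    (hM : IsUnderlyingMatroid C M) (hN : IsUnderlyingMatroid C N) : M = N :=
  Matroid.ext_isCircuit (hM.1.trans hN.1.symm) fun K _ => (hM.2 K).trans (hN.2 K).symm

/-- If the support of `W` were coindependent, some circuit would meet it in exactly one element, and
a one-term inner product is never null. -/
theorem exists_isCocircuit_subset_support (hE : M.E = univ) (hC : IsSignature M C)
    {W : E → WithZero G} (hW : W ∈ F.orthogonalComplement τ C) (h0 : W ≠ 0) :
    ∃ K, M.IsCocircuit K ∧ K ⊆ support W := by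
  by_contra! hcon
  have hind : M✶.Indep (support W) := by
    rw [Matroid.indep_iff_forall_subset_not_isCircuit (by simp [hE])]
    exact fun K hK hKc => hcon K hKc hK
  obtain ⟨e, he⟩ := support_nonempty_iff.2 h0
  obtain ⟨K, hK, hKW⟩ := hind.exists_isCocircuit_inter_eq_mem he
  obtain ⟨X, hX, rfl⟩ := hC.surjective K (by simpa using hK)
  exact not_orthogonal_of_singleton (by rwa [inter_comm] at hKW) (hW X hX)
variable [Finite E]

theorem encard_le_ofNat_iff {s : Set E} (n : ℕ) : s.encard ≤ n ↔ s.ncard ≤ n := by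
  rw [← (toFinite s).cast_ncard_eq, Nat.cast_le]

theorem isWeakDualPair_iff : F.IsWeakDualPair τ M C D ↔ IsDualPair F τ M C D 3 := by
  have h3 : ∀ s : Set E, s.encard ≤ 3 ↔ s.ncard ≤ 3 := fun s => encard_le_ofNat_iff 3
  constructor
  · rintro ⟨h1, h2, h3', h4⟩
    exact ⟨h1, h2, h3', by simpa only [h3] using h4⟩
  · rintro ⟨h1, h2, h3', h4⟩
    exact ⟨h1, h2, h3', by simpa only [h3] using h4⟩

theorem IsDualPair.symm (h : IsDualPair F τ M C D m) : IsDualPair F τ M✶ D C m where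
  ground := h.ground
  left := h.right
  right := by rw [Matroid.dual_dual]; exact h.left
  orthogonal Y hY X hX hc := (h.orthogonal X hX Y hY (by rwa [inter_comm])).symm

theorem IsDualPair.elimAt (h : IsDualPair F τ M C D m) {k : ℕ} (hk : (k + 2 : ℕ) ≤ m) :
    ElimAt F M C k :=
  elimAt_of_orthogonal h.ground h.left h.right fun X hX Y hY hc =>
    h.orthogonal X hX Y hY (((encard_le_ofNat_iff _).2 hc).trans hk)

theorem IsDualPair.isWeakCircuitSet (h : IsDualPair F τ M C D m) (hm : 3 ≤ m) :
    F.IsWeakCircuitSet C :=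
  (h.left.isWeakCircuitSet_iff h.ground).2 (h.elimAt (by exact_mod_cast hm))

theorem IsDualPair.isStrongCircuitSet (h : IsDualPair F τ M C D ⊤) : F.IsStrongCircuitSet C :=
  (h.left.isStrongCircuitSet_iff h.ground).2 fun _ => h.elimAt le_top

/-- The vectors supported on cocircuits of `M` and orthogonal to all members of `C` whose support
they meet in at most two elements. -/
def cosignature (F : Tract G) (τ : F.Involution) (M : Matroid E) (C : Set (E → WithZero G)) :
    Set (E → WithZero G) :=
  {Y | M.IsCocircuit (support Y) ∧
    ∀ X ∈ C, (support X ∩ support Y).ncard ≤ 2 → F.Orthogonal τ X Y}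

/-- Elimination of one element makes a vector exist on every cocircuit; elimination of `k` elements
then raises orthogonality from two common elements to `k + 2`. -/
theorem isDualPair_cosignature (hE : M.E = univ) (hC : IsSignature M C) (h1 : ElimAt F M C 1)
    (hel : ∀ k : ℕ, (k + 2 : ℕ) ≤ m → ElimAt F M C k) :
    IsDualPair F τ M C (cosignature F τ M C) m where
  ground := hE
  left := hC
  right :=
    { zero_notMem := fun h => by simpa using h.1.nonempty
      smul_mem := fun Y hY α => by
        refine ⟨by rw [support_smul_coe]; exact hY.1, fun X hX hc => ?_⟩
        rw [support_smul_coe] at hc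
        exact (hY.2 X hX hc).smul_right _
      isCircuit := fun Y hY => hY.1
      surjective := fun K hK => by
        obtain ⟨Y, rfl, hY⟩ := exists_orthogonal_of_isCocircuit hE hC h1 τ hK
        exact ⟨Y, ⟨hK, hY⟩, rfl⟩
      injective := fun Y hY Y' hY' h =>
        hC.exists_smul_eq_of_orthogonal hE hY.1 h hY.2 hY'.2 }
  orthogonal X hX Y hY hc := by
    by_cases h2 : (support X ∩ support Y).ncard ≤ 2
    · exact hY.2 X hX h2
    · obtain ⟨k, hk⟩ := Nat.exists_eq_add_of_le' (not_le.1 h2).le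
      refine orthogonal_of_elimAt hE hC hY.1 hY.2 (hel k ?_) hX hk
      rwa [← hk, (toFinite _).cast_ncard_eq]

theorem IsDualPair.eq_cosignature (h : IsDualPair F τ M C D m) (hm : 2 ≤ m) :
    D = cosignature F τ M C := by
  have h2 : ∀ X ∈ C, ∀ Y ∈ D, (support X ∩ support Y).ncard ≤ 2 → F.Orthogonal τ X Y :=
    fun X hX Y hY hc => h.orthogonal X hX Y hY (((encard_le_ofNat_iff 2).2 hc).trans hm)
  refine Subset.antisymm (fun Y hY => ⟨h.right.isCircuit Y hY, fun X hX => h2 X hX Y hY⟩)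
    fun Y hY => ?_
  obtain ⟨Y', hY', hYY⟩ := h.right.surjective _ hY.1
  obtain ⟨α, rfl⟩ := h.left.exists_smul_eq_of_orthogonal h.ground hY.1 hYY.symm hY.2
    fun X hX => h2 X hX Y' hY'
  exact h.right.smul_mem _ hY' α

theorem IsDualPair.isWeakDual_iff (h : IsDualPair F τ M C D 3) {D' : Set (E → WithZero G)} :
    F.IsWeakDual τ C D' ↔ D' = D := by
  constructor
  · rintro ⟨N, hN⟩
    rw [isWeakDualPair_iff] at hN
    have hNM := (hN.left.isUnderlyingMatroid hN.ground).unique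
      (h.left.isUnderlyingMatroid h.ground)
    subst hNM
    have h23 : (2 : ℕ∞) ≤ 3 := by norm_num
    rw [hN.eq_cosignature h23, h.eq_cosignature h23]
  · rintro rfl
    exact ⟨M, isWeakDualPair_iff.2 h⟩

/-- Every nonzero vector orthogonal to `C` has a cocircuit inside its support, so the minimal
supports are exactly the cocircuits; on each of them proportionality leaves only the members of `D`.
-/
theorem IsDualPair.dual_eq (h : IsDualPair F τ M C D ⊤) : F.dual τ C = D := by
  have hperp : D ⊆ F.orthogonalComplement τ C := fun Y hY X hX =>
    (h.orthogonal X hX Y hY le_top).symm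
  have hne : ∀ Y ∈ D, Y ≠ 0 := fun Y hY h0 => h.right.zero_notMem (h0 ▸ hY)
  refine Subset.antisymm ?_ fun Y hY => ⟨⟨hperp hY, hne Y hY⟩, fun W hW hWY => ?_⟩
  · rintro W ⟨⟨hW, hW0⟩, hmin⟩
    obtain ⟨K, hK, hKW⟩ := exists_isCocircuit_subset_support h.ground h.left hW hW0
    obtain ⟨Y, hY, rfl⟩ := h.right.surjective K hK
    have hs := hmin Y ⟨hperp hY, hne Y hY⟩ hKW
    rw [h.eq_cosignature le_top]
    exact ⟨hs ▸ hK, fun X hX _ => (hW X hX).symm⟩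
  · obtain ⟨K, hK, hKW⟩ := exists_isCocircuit_subset_support h.ground h.left hW.1 hW.2
    have := Matroid.IsCircuit.eq_of_subset_isCircuit hK (h.right.isCircuit Y hY) (hKW.trans hWY)
    exact hWY.antisymm (this ▸ hKW)

end DualPair

/-! ### Minors of dual pairs -/

section Minors

theorem support_restrict {G : Type*} (X : E → WithZero G) (s : Set E) :
    support (fun e : s => X e) = (↑) ⁻¹' support X := rfl

theorem image_support_restrict {G : Type*} (X : E → WithZero G) :
    (↑) '' support (fun e : ↥Aᶜ => X e) = support X \ A := by
  rw [support_restrict, Subtype.image_preimage_coe, inter_comm, sdiff_eq]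

theorem image_support_restrict_of_disjoint {G : Type*} {X : E → WithZero G} (h : support X ∩ A = ∅) :
    (↑) '' support (fun e : ↥Aᶜ => X e) = support X := by
  rw [image_support_restrict, sdiff_eq_left, disjoint_iff_inter_eq_empty, h]

theorem orthogonal_restrict_iff [Finite E] {X Y : E → WithZero G} (h : support Y ∩ A = ∅) :
    F.Orthogonal τ (fun e : ↥Aᶜ => X e) (fun e : ↥Aᶜ => Y e) ↔ F.Orthogonal τ X Y := by
  have := Fintype.ofFinite ↥Aᶜ
  rw [orthogonal_iff_sum Finset.univ (by simp), orthogonal_iff_sum (toFinite Aᶜ).toFinset,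
    Finset.sum_subtype (toFinite Aᶜ).toFinset (fun x => (toFinite Aᶜ).mem_toFinset)]
  rw [Finite.coe_toFinset]
  exact fun x hx hxA => (h.le ⟨hx.2, hxA⟩).elim

theorem encard_restrict {G : Type*} {X Y : E → WithZero G} (h : support Y ∩ A = ∅) :
    (support (fun e : ↥Aᶜ => X e) ∩ support (fun e : ↥Aᶜ => Y e)).encard =
      (support X ∩ support Y).encard := by
  rw [← Subtype.val_injective.encard_image, image_inter Subtype.val_injective,
    image_support_restrict_of_disjoint h, image_support_restrict]
  congr 1
  ext x
  refine and_congr_left fun hx => and_iff_left fun hxA => (h.le ⟨hx, hxA⟩).elim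

theorem IsSignature.deletion (hC : IsSignature M C) (hE : M.E = univ) (A : Set E) :
    IsSignature ((M ＼ A).restrictSubtype Aᶜ) (Tract.deletion C A) where
  zero_notMem := by
    rintro ⟨X, hX, hXA, h0⟩
    have h1 := image_support_restrict_of_disjoint hXA
    rw [← h0, support_zero, image_empty] at h1
    exact (hC.isCircuit X hX).nonempty.ne_empty h1.symm
  smul_mem := by
    rintro _ ⟨X, hX, hXA, rfl⟩ α
    exact ⟨(α : WithZero G) • X, hC.smul_mem X hX α, by rwa [support_smul_coe], rfl⟩
  isCircuit := by
    rintro _ ⟨X, hX, hXA, rfl⟩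
    rw [Matroid.restrictSubtype_delete_isCircuit_iff hE, image_support_restrict_of_disjoint hXA]
    exact hC.isCircuit X hX
  surjective K hK := by
    rw [Matroid.restrictSubtype_delete_isCircuit_iff hE] at hK
    obtain ⟨X, hX, hXK⟩ := hC.surjective _ hK
    refine ⟨_, ⟨X, hX, ?_, rfl⟩, ?_⟩
    · rw [hXK, ← disjoint_iff_inter_eq_empty]
      exact disjoint_left.2 (by rintro _ ⟨x, _, rfl⟩; exact x.2)
    · rw [support_restrict, hXK, preimage_image_eq _ Subtype.val_injective]
  injective := by
    rintro _ ⟨X, hX, hXA, rfl⟩ _ ⟨Y, hY, hYA, rfl⟩ hXY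
    have := congrArg (image (Subtype.val : ↥Aᶜ → E)) hXY
    rw [image_support_restrict_of_disjoint hXA, image_support_restrict_of_disjoint hYA] at this
    obtain ⟨α, rfl⟩ := hC.injective X hX Y hY this
    exact ⟨α, rfl⟩

theorem IsSignature.exists_restrict_of_isCircuit_contract (hC : IsSignature M C)
    (hE : M.E = univ) {K : Set ↥Aᶜ} (hK : ((M ／ A).restrictSubtype Aᶜ).IsCircuit K) :
    ∃ X ∈ C, support (fun e : ↥Aᶜ => X e) = K := by
  rw [Matroid.restrictSubtype_isCircuit_iff (by simp [hE, compl_eq_univ_sdiff])] at hK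
  obtain ⟨L, hL, hKL, hLK⟩ := hK.exists_subset_isCircuit_of_contract
  obtain ⟨X, hX, rfl⟩ := hC.surjective L hL
  refine ⟨X, hX, Subset.antisymm (fun x hx => ?_) fun x hx => hKL ⟨x, hx, rfl⟩⟩
  rcases hLK hx with ⟨y, hy, hyx⟩ | h
  · rwa [← Subtype.ext hyx]
  · exact absurd h x.2

theorem IsSignature.exists_isCircuit_contract_subset (hC : IsSignature M C)
    {X : E → WithZero G} (hX : X ∈ C) (h0 : (fun e : ↥Aᶜ => X e) ≠ 0) :
    ∃ K, ((M ／ A).restrictSubtype Aᶜ).IsCircuit K ∧ K ⊆ support (fun e : ↥Aᶜ => X e) := by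
  have hdep : (M ／ A).Dep (support X \ A) := by
    refine (hC.isCircuit X hX).contract_dep_of_not_subset fun hXA => h0 (funext fun e => ?_)
    by_contra h
    exact e.2 (hXA h)
  rw [← image_support_restrict] at hdep
  have hdep' : ((M ／ A).restrictSubtype Aᶜ).Dep (support fun e : ↥Aᶜ => X e) :=
    ⟨fun h => hdep.not_indep (Matroid.restrictSubtype_indep_iff.1 h), by simp⟩
  obtain ⟨K, hKX, hK⟩ := hdep'.exists_isCircuit_subset
  exact ⟨K, hK, hKX⟩

theorem IsSignature.contraction_isCircuit (hC : IsSignature M C) (hE : M.E = univ)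
    {W : ↥Aᶜ → WithZero G} (hW : W ∈ Tract.contraction C A) :
    ((M ／ A).restrictSubtype Aᶜ).IsCircuit (support W) := by
  obtain ⟨⟨⟨X, hX, rfl⟩, h0⟩, hmin⟩ := hW
  obtain ⟨K, hK, hKX⟩ := hC.exists_isCircuit_contract_subset hX h0
  obtain ⟨Z, hZ, rfl⟩ := hC.exists_restrict_of_isCircuit_contract hE hK
  rw [← hmin _ ⟨⟨Z, hZ, rfl⟩, fun h => hK.nonempty.ne_empty (support_eq_empty_iff.2 h)⟩ hKX]
  exact hK

variable [Finite E]

/-- The delicate point is that contracted vectors with equal support are proportional, although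
their lifts to `C` may have different supports. Both are orthogonal to the deletion of `D` at two
common elements, and this forces the ratios. -/
theorem IsDualPair.contraction (h : IsDualPair F τ M C D m) (hm : 2 ≤ m) (A : Set E) :
    IsDualPair F τ ((M ／ A).restrictSubtype Aᶜ) (Tract.contraction C A)
      (Tract.deletion D A) m := by
  have hE := h.ground
  have hright : IsSignature ((M ／ A).restrictSubtype Aᶜ)✶ (Tract.deletion D A) := by
    rw [Matroid.restrictSubtype_contract_dual hE]
    exact h.right.deletion hE A
  have horth : ∀ W ∈ Tract.contraction C A, ∀ Y ∈ Tract.deletion D A,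
      (support W ∩ support Y).encard ≤ m → F.Orthogonal τ W Y := by
    rintro _ ⟨⟨⟨X, hX, rfl⟩, -⟩, -⟩ _ ⟨Y, hY, hYA, rfl⟩ hc
    rw [encard_restrict hYA] at hc
    exact (orthogonal_restrict_iff hYA).2 (h.orthogonal X hX Y hY hc)
  refine ⟨Matroid.restrictSubtype_ground, ⟨?_, ?_, ?_, ?_, ?_⟩, hright, horth⟩
  · exact fun h0 => h0.1.2 rfl
  · rintro _ ⟨⟨⟨X, hX, rfl⟩, h0⟩, hmin⟩ α
    have hs := support_smul_coe (X := fun e : ↥Aᶜ => X e) α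
    refine ⟨⟨⟨_, h.left.smul_mem X hX α, rfl⟩, fun h' => h0 ?_⟩, fun Y hY hYX => ?_⟩
    · rw [mem_singleton_iff, ← support_eq_empty_iff] at h' ⊢
      rwa [hs] at h'
    · rw [hs] at hYX ⊢
      exact hmin Y hY hYX
  · exact fun W hW => h.left.contraction_isCircuit hE hW
  · intro K hK
    obtain ⟨X, hX, rfl⟩ := h.left.exists_restrict_of_isCircuit_contract hE hK
    refine ⟨_, ⟨⟨⟨X, hX, rfl⟩, fun h' => hK.nonempty.ne_empty (support_eq_empty_iff.2 h')⟩, ?_⟩, rfl⟩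
    rintro _ ⟨⟨Y, hY, rfl⟩, hY0⟩ hYX
    obtain ⟨L, hL, hLY⟩ := h.left.exists_isCircuit_contract_subset hY hY0
    exact hYX.antisymm ((hL.eq_of_subset_isCircuit hK (hLY.trans hYX)) ▸ hLY)
  · intro W hW W' hW' hWW
    have key : ∀ V ∈ Tract.contraction C A, ∀ Y ∈ Tract.deletion D A,
        (support Y ∩ support V).ncard ≤ 2 → F.Orthogonal τ Y V := fun V hV Y hY hc =>
      (horth V hV Y hY (by
        rw [inter_comm]
        exact ((encard_le_ofNat_iff 2).2 hc).trans hm)).symm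
    refine hright.exists_smul_eq_of_orthogonal (τ := τ)
      (M := ((M ／ A).restrictSubtype Aᶜ)✶) Matroid.restrictSubtype_ground
      (Matroid.IsCircuit.isCocircuit (h.left.contraction_isCircuit hE hW)) hWW
      (key W hW) (key W' hW')

/-- This is contraction with the two halves of the pair exchanged. -/
theorem IsDualPair.deletion (h : IsDualPair F τ M C D m) (hm : 2 ≤ m) (A : Set E) :
    IsDualPair F τ ((M ＼ A).restrictSubtype Aᶜ) (Tract.deletion C A)
      (Tract.contraction D A) m := by
  have := (h.symm.contraction hm A).symm
  rwa [Matroid.restrictSubtype_contract_dual (M := M✶) h.ground, Matroid.dual_dual] at this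

end Minors

/-! ### The underlying matroid and existence of dual pairs -/

section UnderlyingMatroid

/-- Circuit elimination is proved by induction on the size of the union. A non-modular pair encloses
two distinct supports with smaller union: either one of them already avoids `e`, or the induction
hypothesis applies to them. -/
theorem IsWeakCircuitSet.exists_isUnderlyingMatroid [Finite E] (h : F.IsWeakCircuitSet C) :
    ∃ M : Matroid E, IsUnderlyingMatroid C M := by
  have heq : ∀ X ∈ C, ∀ Y ∈ C, support X ⊆ support Y → support X = support Y := by
    intro X hX Y hY hXY
    obtain ⟨α, rfl⟩ := h.incomparable X hX Y hY hXY
    exact support_smul_coe α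
  refine Matroid.exists_of_circuit_axioms (supports C) ?_ ?_ ?_
  · rintro ⟨X, hX, h0⟩
    exact h.zero_notMem (support_eq_empty_iff.1 h0 ▸ hX)
  · rintro _ ⟨X, hX, rfl⟩ _ ⟨Y, hY, rfl⟩
    exact heq X hX Y hY
  · suffices hs : ∀ n : ℕ, ∀ K ∈ supports C, ∀ L ∈ supports C, (K ∪ L).ncard = n → K ≠ L →
        ∀ e ∈ K ∩ L, ∃ J ∈ supports C, J ⊆ (K ∪ L) \ {e} from
      fun K hK L hL => hs _ K hK L hL rfl
    intro n
    induction n using Nat.strong_induction_on with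
    | _ n ih =>
      rintro _ ⟨X, hX, rfl⟩ _ ⟨Y, hY, rfl⟩ hn hne e ⟨heX, heY⟩
      by_cases hmod : IsModularPair (supports C) (support X) (support Y)
      · have hα : F.neg (X e) / Y e ≠ 0 := div_ne_zero (F.neg_eq_zero.not.2 heX) heY
        have hs : support ((F.neg (X e) / Y e) • Y) = support Y := support_smul_of_ne_zero hα
        obtain ⟨Z, hZ, hZe, hZf⟩ := h.modular_elimination X hX _
          (smul_mem_of_ne_zero h.smul_mem hY hα) (by rwa [hs]) e
          (by simp [div_mul_cancel₀ _ (show Y e ≠ 0 from heY), F.neg_neg]) heX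
        refine ⟨_, ⟨Z, hZ, rfl⟩, fun x hx => ⟨?_, ?_⟩⟩
        · by_contra hxU
          rw [← hs] at hxU
          simp only [mem_union, mem_support, not_or, not_not] at hxU
          have := hZf x
          rw [hxU.1, hxU.2, map_zero, zero_add, zero_add, F.toSum_mem_iff, F.neg_eq_zero] at this
          exact hx this
        · rintro rfl
          exact hx hZe
      · have : ∃ K ∈ supports C, ∃ L ∈ supports C, K ≠ L ∧ K ∪ L ⊂ support X ∪ support Y := by
          by_contra hcon
          exact hmod ⟨⟨X, hX, rfl⟩, ⟨Y, hY, rfl⟩, hne, hcon⟩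
        obtain ⟨K, hK, L, hL, hKL, hlt⟩ := this
        by_cases heK : e ∈ K
        · by_cases heL : e ∈ L
          · obtain ⟨J, hJ, hJs⟩ := ih _ (hn ▸ ncard_lt_ncard hlt) K hK L hL rfl hKL e ⟨heK, heL⟩
            exact ⟨J, hJ, hJs.trans (sdiff_subset_sdiff_left hlt.subset)⟩
          · exact ⟨L, hL, subset_sdiff_singleton (subset_union_right.trans hlt.subset) heL⟩
        · exact ⟨K, hK, subset_sdiff_singleton (subset_union_left.trans hlt.subset) heK⟩

/-- The height is computed directly because no matroid is available yet. A chain with two nonempty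
unions below `K ∪ L` would contain two distinct members whose union is strictly smaller than `K ∪
L`. -/
theorem isModularFamily_of_isModularPair {S : Set (Set E)} {K L : Set E}
    (h : IsModularPair S K L) (hne : K.Nonempty) (hLK : ¬ L ⊆ K) :
    IsModularFamily S (Fin.cons K (fun _ => L) : Fin 2 → Set E) := by
  obtain ⟨hK, hL, -, hmod⟩ := h
  have hU : ⋃ i, (Fin.cons K (fun _ => L) : Fin 2 → Set E) i = K ∪ L := by
    rw [iUnion_cons, iUnion_fin_one]
  have hmem : K ∪ L ∈ unionLattice S :=
    ⟨{K, L}, insert_subset hK (singleton_subset_iff.2 hL), by simp⟩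
  have hheight : Order.height (⟨K ∪ L, hmem⟩ : unionLattice S) = 2 := by
    refine le_antisymm ?_ ?_
    · rw [show (2 : ℕ∞) = (2 : ℕ) from rfl, Order.height_le_coe_iff]
      rintro ⟨V, T, hT, rfl⟩ hV
      refine lt_of_le_of_lt ((Order.height_le_coe_iff (n := 1)).2 ?_) (by norm_num)
      rintro ⟨W, T', hT', rfl⟩ hW
      rw [Nat.cast_one, Order.lt_one_iff, Order.height_eq_zero]
      have h0 : ⋃₀ T' = ∅ := by
        by_contra hne'
        obtain ⟨x, P, hP, hx⟩ := nonempty_iff_ne_empty.2 hne'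
        obtain ⟨hle, hnot⟩ : ⋃₀ T' ⊆ ⋃₀ T ∧ ¬ ⋃₀ T ⊆ ⋃₀ T' := hW
        obtain ⟨hle', hnot'⟩ : ⋃₀ T ⊆ K ∪ L ∧ ¬ K ∪ L ⊆ ⋃₀ T := hV
        obtain ⟨y, ⟨Q, hQ, hy⟩, hyW⟩ := not_subset.1 hnot
        have hPQ : P ∪ Q ⊆ ⋃₀ T :=
          union_subset ((subset_sUnion_of_mem hP).trans hle) (subset_sUnion_of_mem hQ)
        exact hmod ⟨P, hT' hP, Q, hT hQ, fun h => hyW ⟨P, hP, h ▸ hy⟩, hPQ.trans hle',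
          fun h => hnot' (h.trans hPQ)⟩
      intro V _ x hx
      exact absurd (h0 ▸ hx : x ∈ (∅ : Set E)) (notMem_empty x)
    · have hK' : K ∈ unionLattice S := ⟨{K}, singleton_subset_iff.2 hK, by simp⟩
      have h0' : ∅ ∈ unionLattice S := ⟨∅, empty_subset _, by simp⟩
      have h1 : (⟨∅, h0'⟩ : unionLattice S) < ⟨K, hK'⟩ :=
        ⟨empty_subset _, fun h => hne.ne_empty (subset_empty_iff.1 h)⟩
      have h2 : (⟨K, hK'⟩ : unionLattice S) < ⟨K ∪ L, hmem⟩ :=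
        ⟨subset_union_left, fun h => hLK (subset_union_right.trans h)⟩
      calc (2 : ℕ∞) = 0 + 1 + 1 := by norm_num
        _ ≤ Order.height (⟨∅, h0'⟩ : unionLattice S) + 1 + 1 := by gcongr; exact zero_le
        _ ≤ Order.height (⟨K, hK'⟩ : unionLattice S) + 1 := by
          gcongr
          exact Order.height_add_one_le h1
        _ ≤ _ := Order.height_add_one_le h2
  refine ⟨fun i => Fin.cases hK (fun _ => hL) i, ?_⟩
  rw [← hU] at hmem
  refine ⟨hmem, ?_⟩
  simp only [hU]
  exact hheight

theorem IsStrongCircuitSet.isWeakCircuitSet (h : F.IsStrongCircuitSet C) :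
    F.IsWeakCircuitSet C := by
  refine ⟨h.toIsPreCircuitSet, fun X hX Y hY hmod e hXe hne => ?_⟩
  have hYe : Y e ≠ 0 := fun h0 => hne (by rw [hXe, h0, F.neg_zero])
  have hsub : ∀ X ∈ C, ∀ Y ∈ C, support X ⊆ support Y → support X = support Y := by
    intro X hX Y hY hXY
    obtain ⟨α, rfl⟩ := h.incomparable X hX Y hY hXY
    exact support_smul_coe α
  obtain ⟨Z, hZ, hZe, hZf⟩ := h.strong_modular_elimination 1 X (fun _ => Y) hX (fun _ => hY)
    (isModularFamily_of_isModularPair hmod ⟨e, hne⟩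
      fun hYX => hmod.2.2.1 (hsub Y hY X hX hYX).symm)
    (fun hXY => hmod.2.2.1 (hsub X hX Y hY (by rwa [iUnion_fin_one] at hXY))) (fun _ => e)
    (fun i => ⟨⟨hne, hYe⟩, fun j hj => absurd (Subsingleton.elim _ _) hj⟩) (fun _ => hXe)
  refine ⟨Z, hZ, hZe 0, fun f => ?_⟩
  have := hZf f
  rwa [Fin.sum_univ_one, add_comm (toSum (Y f))] at this

theorem IsWeakCircuitSet.exists_isDualPair [Finite E] (h : F.IsWeakCircuitSet C)
    (τ : F.Involution) : ∃ M D, IsDualPair F τ M C D 3 := by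
  obtain ⟨M, hM⟩ := h.exists_isUnderlyingMatroid
  have hC := h.toIsPreCircuitSet.isSignature hM
  have h1 := (hC.isWeakCircuitSet_iff hM.1).1 h
  refine ⟨M, _, isDualPair_cosignature hM.1 hC h1 fun k hk => ?_⟩
  have hk' : k + 2 ≤ 3 := by exact_mod_cast hk
  obtain rfl | rfl : k = 0 ∨ k = 1 := by omega
  -- With nothing to eliminate, `Z = X` works because `X - X` is null.
  · intro X Y hX _ _ _ _ _ _
    exact ⟨X, hX, fun i => i.elim0, fun f => by simpa using F.add_mem_iff.2 rfl⟩
  · exact h1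

theorem IsStrongCircuitSet.exists_isDualPair [Finite E] (h : F.IsStrongCircuitSet C)
    (τ : F.Involution) : ∃ M D, IsDualPair F τ M C D ⊤ := by
  obtain ⟨M, hM⟩ := h.isWeakCircuitSet.exists_isUnderlyingMatroid
  have hC := h.toIsPreCircuitSet.isSignature hM
  have hel := (hC.isStrongCircuitSet_iff hM.1).1 h
  exact ⟨M, _, isDualPair_cosignature hM.1 hC (hel 1) fun k _ => hel k⟩

end UnderlyingMatroid
end Tract
theorem theorem3p14 {G : Type*} [CommGroup G] (F : Tract G) (τ : F.Involution)
    {E : Type*} [Finite E] (C : Set (E → WithZero G)) (A : Set E) :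
    (F.IsStrongCircuitSet C →
      F.IsStrongCircuitSet (Tract.deletion C A) ∧
      F.IsStrongCircuitSet (Tract.contraction C A) ∧
      (∃ M : Matroid E, Tract.IsUnderlyingMatroid C M ∧
        Tract.IsUnderlyingMatroid (Tract.deletion C A) ((M.delete A).restrictSubtype Aᶜ) ∧
        Tract.IsUnderlyingMatroid (Tract.contraction C A) ((M.contract A).restrictSubtype Aᶜ)) ∧
      F.IsStrongCircuitSet (F.dual τ C) ∧
      F.dual τ (Tract.deletion C A) = Tract.contraction (F.dual τ C) A ∧
      F.dual τ (Tract.contraction C A) = Tract.deletion (F.dual τ C) A) ∧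
    (F.IsWeakCircuitSet C →
      F.IsWeakCircuitSet (Tract.deletion C A) ∧
      F.IsWeakCircuitSet (Tract.contraction C A) ∧
      (∃ M : Matroid E, Tract.IsUnderlyingMatroid C M ∧
        Tract.IsUnderlyingMatroid (Tract.deletion C A) ((M.delete A).restrictSubtype Aᶜ) ∧
        Tract.IsUnderlyingMatroid (Tract.contraction C A) ((M.contract A).restrictSubtype Aᶜ)) ∧
      (∃ D : Set (E → WithZero G), F.IsWeakCircuitSet D ∧
        (∀ D', F.IsWeakDual τ C D' ↔ D' = D) ∧
        (∀ D', F.IsWeakDual τ (Tract.deletion C A) D' ↔ D' = Tract.contraction D A) ∧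
        (∀ D', F.IsWeakDual τ (Tract.contraction C A) D' ↔ D' = Tract.deletion D A))) := by
  constructor
  · intro h
    obtain ⟨M, D, hp⟩ := h.exists_isDualPair τ
    have hd := hp.deletion le_top A
    have hc := hp.contraction le_top A
    refine ⟨hd.isStrongCircuitSet, hc.isStrongCircuitSet,
      ⟨M, hp.left.isUnderlyingMatroid hp.ground, hd.left.isUnderlyingMatroid hd.ground,
        hc.left.isUnderlyingMatroid hc.ground⟩, ?_, ?_, ?_⟩
    · rw [hp.dual_eq]
      exact hp.symm.isStrongCircuitSet
    · rw [hp.dual_eq, hd.dual_eq]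
    · rw [hp.dual_eq, hc.dual_eq]
  · intro h
    obtain ⟨M, D, hp⟩ := h.exists_isDualPair τ
    have h23 : (2 : ℕ∞) ≤ 3 := by norm_num
    have hd := hp.deletion h23 A
    have hc := hp.contraction h23 A
    exact ⟨hd.isWeakCircuitSet le_rfl, hc.isWeakCircuitSet le_rfl,
      ⟨M, hp.left.isUnderlyingMatroid hp.ground, hd.left.isUnderlyingMatroid hd.ground,
        hc.left.isUnderlyingMatroid hc.ground⟩,
      ⟨D, hp.symm.isWeakCircuitSet le_rfl, fun _ => hp.isWeakDual_iff,
        fun _ => hd.isWeakDual_iff, fun _ => hc.isWeakDual_iff⟩⟩
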